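/- Let $S\subset\mathbb C$ be a plane domain (a non-empty connected open set) with infinitely many boundary points. Let $Bel(S)$ be the space of (classes modulo a.e. equality of) essentially bounded measurable functions $\mu$ on $S$ with the norm $\|\mu\|_\infty=\operatorname{ess\,sup}_S|\mu|$, and let $Q(S)$ be the space of holomorphic functions $\varphi$ on $S$ with $\|\varphi\|=\iint_S|\varphi|\,dx\,dy<\infty$. Call $\mu,\nu\in Bel(S)$ infinitesimally equivalent if $\iint_S(\mu-\nu)\varphi\,dx\,dy=0$ for all $\varphi\in Q(S)$; let $[\mu]_Z$ be the equivalence class of $\mu$, let $Z(S)$ be the quotient space, and put $\|[\mu]_Z\|=\sup\{\operatorname{Re}\iint_S\mu\varphi\,dx\,dy:\ \varphi\in Q(S),\ \|\varphi\|=1\}$. An element $\mu\in Bel(S)$ is extremal (in $[\mu]_Z$) if $\|\mu\|_\infty=\|[\mu]_Z\|$. It is of landslide type if there is a non-empty open set $E\subset S$ with $\operatorname{ess\,sup}_{E}|\mu|<\|\mu\|_\infty$, and of non-landslide type otherwise. It has constant modulus if $|\mu|$ is a.e. equal to a constant on $S$, and non-constant modulus otherwise. Then there is a point $[\mu]_Z$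 in $Z(S)$ such that $[\mu]_Z$ contains infinitely many non-landslide extremals, and each non-landslide extremal in $[\mu]_Z$ is of non-constant modulus. -/

import Mathlib

open MeasureTheory

noncomputable section

namespace Teich

/-- `Bel(S)`: essentially bounded measurable functions on `S`, modulo equality almost everywhere,
with the essential supremum norm. -/
abbrev Bel (S : Set ℂ) : Type := Lp ℂ ⊤ (volume.restrict S)

/-- `Q(S)`: functions that are holomorphic and integrable on `S`. The values of `φ` outside `S`
are irrelevant, since `φ` is only ever used on `S`. -/
def Q (S : Set ℂ) : Set (ℂ → ℂ) :=
  {φ | DifferentiableOn ℂ φ S ∧ IntegrableOn φ S volume}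

/-- The unit sphere of `Q(S)` for the `L¹` norm. -/
def Q1 (S : Set ℂ) : Set (ℂ → ℂ) :=
  {φ | φ ∈ Q S ∧ ∫ z in S, ‖φ z‖ = 1}

/-- The pairing of a Beltrami differential with a quadratic differential. -/
def pairing {S : Set ℂ} (μ : Bel S) (φ : ℂ → ℂ) : ℂ := ∫ z in S, μ z * φ z

theorem integrable_mul {S : Set ℂ} (μ : Bel S) {φ : ℂ → ℂ} (hφ : φ ∈ Q S) :
    Integrable (fun z => μ z * φ z) (volume.restrict S) :=
  Integrable.mul_of_top_right hφ.2 (Lp.memLp μ)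

theorem pairing_add {S : Set ℂ} (μ ν : Bel S) {φ : ℂ → ℂ} (hφ : φ ∈ Q S) :
    pairing (μ + ν) φ = pairing μ φ + pairing ν φ := by
  unfold pairing
  rw [← integral_add (integrable_mul μ hφ) (integrable_mul ν hφ)]
  refine integral_congr_ae ?_
  filter_upwards [Lp.coeFn_add μ ν] with z hz
  rw [hz, Pi.add_apply, add_mul]

theorem pairing_smul {S : Set ℂ} (c : ℂ) (μ : Bel S) (φ : ℂ → ℂ) :
    pairing (c • μ) φ = c * pairing μ φ := by
  unfold pairing
  rw [← integral_const_mul]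
  refine integral_congr_ae ?_
  filter_upwards [Lp.coeFn_smul c μ] with z hz
  rw [hz, Pi.smul_apply, smul_eq_mul, mul_assoc]

/-- `N(S)`: the Beltrami differentials that are infinitesimally equivalent to `0`. -/
def N (S : Set ℂ) : Submodule ℂ (Bel S) where
  carrier := {μ | ∀ φ ∈ Q S, pairing μ φ = 0}
  zero_mem' := by
    intro φ _
    have h := pairing_smul (0 : ℂ) (0 : Bel S) φ
    rwa [zero_smul, zero_mul] at h
  add_mem' := by
    intro μ ν hμ hν φ hφ
    rw [pairing_add μ ν hφ, hμ φ hφ, hν φ hφ, add_zero]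
  smul_mem' := by
    intro c μ hμ φ hφ
    rw [pairing_smul, hμ φ hφ, mul_zero]

/-- `Z(S)`: Beltrami differentials modulo infinitesimal equivalence, where `μ` and `ν` are
equivalent when `μ - ν` pairs to `0` with every element of `Q(S)`. -/
abbrev Z (S : Set ℂ) : Type := Bel S ⧸ N S

/-- The class `[μ]_Z`. -/
def cls {S : Set ℂ} (μ : Bel S) : Z S := (N S).mkQ μ

/-- The standard sup-norm of a point of `Z(S)`: the supremum of `Re ∬ μ φ` over the unit sphere
of `Q(S)`. The value of the integral does not depend on the representative `μ` of the point. -/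
def classNorm {S : Set ℂ} (x : Z S) : ℝ :=
  sSup {r : ℝ | ∃ μ : Bel S, cls μ = x ∧ ∃ φ ∈ Q1 S, r = (pairing μ φ).re}

/-- `μ` is extremal in its class. -/
def IsExtremal {S : Set ℂ} (μ : Bel S) : Prop := ‖μ‖ = classNorm (cls μ)

/-- `μ` is of landslide type: on some non-empty open subset `E` of `S` the essential supremum
of `|μ|` is smaller than on `S`. -/
def IsLandslide {S : Set ℂ} (μ : Bel S) : Prop :=
  ∃ E : Set ℂ, IsOpen E ∧ E.Nonempty ∧ E ⊆ S ∧
    eLpNormEssSup μ (volume.restrict E) < eLpNormEssSup μ (volume.restrict S)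

/-- `μ` has constant modulus: `|μ|` is almost everywhere equal to a constant on `S`. -/
def HasConstantModulus {S : Set ℂ} (μ : Bel S) : Prop :=
  ∃ c : ℝ, ∀ᵐ z ∂(volume.restrict S), ‖μ z‖ = c

/-- The non-landslide extremals contained in the point `x` of `Z(S)`. -/
def nonLandslideExtremals {S : Set ℂ} (x : Z S) : Set (Bel S) :=
  {μ | cls μ = x ∧ IsExtremal μ ∧ ¬ IsLandslide μ}

end Teich

end

namespace Teich

/-! The class is built around a set `C` of positive measure on which every extremal of the class
must vanish, while every non-empty open subset of `S` meets the complement of `C` in positive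
measure. A function of norm 1 that vanishes on `C` has non-constant modulus; if it is unimodular off
`C`, it is of non-landslide type.

The forcing works as follows. Fix a disc `Δ` in `S` and a sequence `ψ n` that returns arbitrarily
close to every element of `L¹(Δ)`. Suppose `φ n ∈ Q(S)` is close to `ψ n` on `C` and carries nearly
all its remaining mass on `B n`, where the `B n` are pairwise disjoint (`ConcentratedSystem`). Let
`μ` be 0 on `C`, the conjugate phase of `φ n` on `B n`, and unimodular elsewhere. If `ν` is
equivalent to `μ` and `|ν| ≤ 1`, then `Re ∫ ν φ n = Re ∫ μ φ n` nearly exhausts `∫ |φ n|` off `C`,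
so `Re ∫_C ν ψ n ≥ -o(1)`. Letting `ψ n` approach `-conj ν` on `C` gives `∫_C |ν|² ≤ 0`
(`Aligned.ae_eq_zero`). The mass of `φ n` is also made huge compared with its mass on `C`, so the
normalised `φ n` show that the class has norm 1 (`Aligned.classNorm_eq_one`).

Infinitely many extremals come from a disc about `y` disjoint from `Δ` and all `B n`: there `μ` may
be `t (z - y) / |z - y|` for any `|t| = 1`, because this function annihilates `Q(S)`.

The `φ n` come from a Runge-type approximation (`exists_Q_approx`). By Hahn-Banach, approximation
off an open set `O` reduces to a uniqueness statement for Cauchy transforms vanishing on the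
complement of `S`. An `O` of tiny measure suffices if it contains a connected net of circles leading
to an accumulation point of that complement, possibly infinity: the Cauchy transform is holomorphic
on `O`, so it vanishes along the net, and its density then has integral zero over all small discs.
-/

/-! ### Duality and approximation in `L¹`. -/

/-- Every continuous functional on `L¹` of a finite measure is integration against a bounded
function. -/
theorem exists_bounded_integral_eq {α : Type*} [MeasurableSpace α] {μ : Measure α}
    [IsFiniteMeasure μ] (L : Lp ℂ 1 μ →L[ℂ] ℂ) :
    ∃ ν : α → ℂ, Measurable ν ∧ (∀ x, ‖ν x‖ ≤ ‖L‖) ∧ ∀ f : Lp ℂ 1 μ, L f = ∫ x, ν x * f x ∂μ := by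
  have hone : MemLp (fun _ : α => (1 : ℂ)) 2 μ := memLp_const 1
  let ι : Lp ℂ 2 μ →L[ℂ] Lp ℂ 1 μ :=
    (ContinuousLinearMap.mul ℂ ℂ).holderL μ 2 2 1 (hone.toLp _)
  have hι : ∀ g : Lp ℂ 2 μ, ι g =ᵐ[μ] g := by
    intro g
    have h1 := (ContinuousLinearMap.mul ℂ ℂ).coeFn_holder (r := 1) (hone.toLp _) g
    filter_upwards [h1, hone.coeFn_toLp] with x hx hx1
    change ((ContinuousLinearMap.mul ℂ ℂ).holder 1 (hone.toLp _) g) x = _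
    rw [hx, hx1]; simp
  let h : Lp ℂ 2 μ := (InnerProductSpace.toDual ℂ (Lp ℂ 2 μ)).symm (L ∘L ι)
  have hh : ∀ g : Lp ℂ 2 μ, L (ι g) = ∫ x, starRingEnd ℂ (h x) * g x ∂μ := by
    intro g
    have h1 : inner ℂ h g = (L ∘L ι) g := InnerProductSpace.toDual_symm_apply
    rw [L2.inner_def] at h1
    rw [← ContinuousLinearMap.comp_apply, ← h1]
    refine integral_congr_ae (.of_forall fun x => ?_)
    simp [RCLike.inner_apply, mul_comm]
  obtain ⟨k, hkm, hk⟩ : ∃ k : α → ℂ, Measurable k ∧ h =ᵐ[μ] k :=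
    ⟨_, (Lp.stronglyMeasurable h).measurable, ae_eq_rfl⟩
  have hkint : Integrable k μ := ((Lp.memLp h).ae_eq hk).integrable (by norm_num)
  have hbound : ∀ᵐ x ∂μ, ‖k x‖ ≤ ‖L‖ := by
    -- Testing `L` on the phase of `k` over `E` gives `∫_E |k| ≤ ‖L‖ μ(E)`, so `E` is null.
    let E := {x | ‖L‖ < ‖k x‖}
    have hE : MeasurableSet E := measurableSet_lt measurable_const hkm.norm
    let g : α → ℂ := E.indicator fun x => k x / ‖k x‖
    have hgm : Measurable g := (hkm.div (Complex.measurable_ofReal.comp hkm.norm)).indicator hE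
    have hgle : ∀ x, ‖g x‖ ≤ E.indicator (fun _ => (1 : ℝ)) x := by
      intro x
      by_cases hx : x ∈ E
      · simp only [g, Set.indicator_of_mem hx, norm_div, Complex.norm_real, norm_norm]
        exact div_self_le_one _
      · simp [g, hx]
    have hgle1 : ∀ x, ‖g x‖ ≤ 1 := fun x =>
      (hgle x).trans (Set.indicator_le_self' (fun _ _ => zero_le_one) x)
    have hg : MemLp g 2 μ := MemLp.of_bound hgm.aestronglyMeasurable 1 (.of_forall hgle1)
    have h1 : L (ι (hg.toLp g)) = ((∫ x in E, ‖k x‖ ∂μ : ℝ) : ℂ) := by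
      rw [hh, ← integral_indicator hE, ← integral_complex_ofReal]
      refine integral_congr_ae ?_
      filter_upwards [hk, hg.coeFn_toLp] with x hx hx2
      rw [hx, hx2]
      by_cases hxE : x ∈ E
      · simp only [g, Set.indicator_of_mem hxE]
        have : (‖k x‖ : ℂ) ≠ 0 := by
          exact_mod_cast (lt_of_le_of_lt (norm_nonneg L) hxE).ne'
        rw [← mul_div_assoc, div_eq_iff this, mul_comm, Complex.mul_conj, Complex.normSq_eq_norm_sq]
        push_cast; ring
      · simp [g, hxE]
    have h2 : ‖ι (hg.toLp g)‖ ≤ μ.real E := by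
      rw [L1.norm_eq_integral_norm]
      have : ∫ x, E.indicator (fun _ => (1 : ℝ)) x ∂μ = μ.real E := by
        rw [integral_indicator hE]; simp
      rw [← this]
      refine integral_mono_ae (L1.integrable_coeFn _).norm
        ((integrable_const (1 : ℝ)).indicator hE) ?_
      filter_upwards [hι (hg.toLp g), hg.coeFn_toLp] with x hx hx2
      rw [hx, hx2]; exact hgle x
    have h3 : ∫ x in E, ‖k x‖ ∂μ ≤ ∫ x in E, ‖L‖ ∂μ := by
      have h4 := (L.le_opNorm (ι (hg.toLp g))).trans
        (mul_le_mul_of_nonneg_left h2 (norm_nonneg _))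
      rw [h1, Complex.norm_real] at h4
      refine (le_abs_self _).trans (h4.trans ?_)
      simp [mul_comm]
    have h5 : ∫ x in E, (‖k x‖ - ‖L‖) ∂μ ≤ 0 := by
      rw [integral_sub hkint.norm.integrableOn (integrable_const _)]; linarith
    have h6 : (fun x => ‖k x‖ - ‖L‖) =ᵐ[μ.restrict E] 0 := by
      rw [← integral_eq_zero_iff_of_nonneg_ae]
      · refine le_antisymm h5 (setIntegral_nonneg hE fun x hx => ?_)
        exact (sub_pos.2 hx).le
      · exact (ae_restrict_iff' hE).2 (.of_forall fun x hx => (sub_pos.2 hx).le)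
      · exact (hkint.norm.sub (integrable_const _)).integrableOn
    rw [Filter.EventuallyEq, ae_restrict_iff' hE] at h6
    filter_upwards [h6] with x hx
    by_contra hcon
    have := hx (not_le.1 hcon)
    simp only [Pi.zero_apply] at this
    exact hcon (by linarith)
  let E := {x | ‖k x‖ ≤ ‖L‖}
  have hE : MeasurableSet E := measurableSet_le hkm.norm measurable_const
  have hνk : (E.indicator fun x => starRingEnd ℂ (k x)) =ᵐ[μ] fun x => starRingEnd ℂ (h x) := by
    filter_upwards [hbound, hk] with x hx hx2
    rw [Set.indicator_of_mem (show x ∈ E from hx), hx2]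
  have hνb : ∀ x, ‖E.indicator (fun x => starRingEnd ℂ (k x)) x‖ ≤ ‖L‖ := by
    intro x
    by_cases hx : x ∈ E
    · rw [Set.indicator_of_mem hx, RCLike.norm_conj]; exact hx
    · simp [hx]
  have hνm : Measurable (E.indicator fun x => starRingEnd ℂ (k x)) :=
    (Complex.continuous_conj.measurable.comp hkm).indicator hE
  refine ⟨E.indicator fun x => starRingEnd ℂ (k x), hνm, hνb, ?_⟩
  set ν := E.indicator fun x => starRingEnd ℂ (k x)
  have hint : ∀ f : Lp ℂ 1 μ, Integrable (fun x => ν x * f x) μ := fun f =>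
    (L1.integrable_coeFn f).bdd_mul hνm.aestronglyMeasurable (.of_forall hνb)
  let R : Lp ℂ 1 μ →L[ℂ] ℂ := LinearMap.mkContinuous
    { toFun := fun f => ∫ x, ν x * f x ∂μ
      map_add' := by
        intro f g
        rw [← integral_add (hint f) (hint g)]
        refine integral_congr_ae ?_
        filter_upwards [Lp.coeFn_add f g] with x hx
        rw [hx, Pi.add_apply, mul_add]
      map_smul' := by
        intro c f
        rw [RingHom.id_apply, smul_eq_mul, ← integral_const_mul]
        refine integral_congr_ae ?_
        filter_upwards [Lp.coeFn_smul c f] with x hx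
        rw [hx, Pi.smul_apply, smul_eq_mul]; ring } ‖L‖ (by
      intro f
      rw [L1.norm_eq_integral_norm, ← integral_const_mul]
      refine norm_integral_le_of_norm_le ((L1.integrable_coeFn f).norm.const_mul _)
        (.of_forall fun x => ?_)
      rw [norm_mul]
      exact mul_le_mul_of_nonneg_right (hνb x) (norm_nonneg _))
  suffices L = R by
    intro f; rw [this]; rfl
  ext f
  refine Lp.induction (by norm_num) (fun f => L f = R f) ?_ ?_ ?_ f
  · intro c s hs hμs
    have hg : MemLp (s.indicator fun _ => c) 2 μ := memLp_indicator_const 2 hs c (.inr hμs.ne)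
    have h1 : (Lp.simpleFunc.indicatorConst 1 hs hμs.ne c : Lp ℂ 1 μ) = ι (hg.toLp _) := by
      refine Lp.ext ?_
      filter_upwards [hι (hg.toLp _), hg.coeFn_toLp, indicatorConstLp_coeFn (p := 1) (hs := hs)
        (hμs := hμs.ne) (c := c)] with x hx hx2 hx3
      rw [hx, hx2, Lp.simpleFunc.coe_indicatorConst, hx3]
    rw [h1, hh]
    refine integral_congr_ae ?_
    filter_upwards [hνk, hι (hg.toLp _)] with x hx hx2
    rw [hx2, ← hx]
  · intro f g hf hg _ h1 h2
    rw [map_add, map_add, h1, h2]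
  · exact isClosed_eq L.continuous R.continuous

/-- Hahn-Banach: otherwise a functional separates `f` from the closure of `M`, and it is integration
against a bounded function. -/
theorem exists_mem_integral_norm_sub_lt_of_finite {α : Type*} [MeasurableSpace α] {μ : Measure α}
    [IsFiniteMeasure μ] (M : Submodule ℂ (α → ℂ)) (hM : ∀ φ ∈ M, Integrable φ μ) {f : α → ℂ}
    (hf : Integrable f μ)
    (h : ∀ ν : α → ℂ, Measurable ν → (∃ C, ∀ x, ‖ν x‖ ≤ C) →
      (∀ φ ∈ M, ∫ x, ν x * φ x ∂μ = 0) → ∫ x, ν x * f x ∂μ = 0)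
    {ε : ℝ} (hε : 0 < ε) : ∃ φ ∈ M, ∫ x, ‖φ x - f x‖ ∂μ < ε := by
  let T : M →ₗ[ℂ] Lp ℂ 1 μ :=
    { toFun := fun φ => (hM φ φ.2).toL1 φ
      map_add' := fun φ ψ => Integrable.toL1_add _ _ (hM φ φ.2) (hM ψ ψ.2)
      map_smul' := fun c φ => Integrable.toL1_smul _ (hM φ φ.2) c }
  let V : Submodule ℂ (Lp ℂ 1 μ) := LinearMap.range T
  have hmem : hf.toL1 f ∈ V.topologicalClosure := by
    by_contra hcon
    obtain ⟨L, hL1, hL2⟩ : ∃ L : Lp ℂ 1 μ →L[ℂ] ℂ, L (hf.toL1 f) ≠ 0 ∧ ∀ v ∈ V, L v = 0 := by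
      obtain ⟨L, u, hL1, hL2⟩ := RCLike.geometric_hahn_banach_point_closed (𝕜 := ℂ)
        ((V.topologicalClosure.restrictScalars ℝ).convex) V.isClosed_topologicalClosure hcon
      have hV : ∀ v ∈ V, u < RCLike.re (L v) := fun v hv => hL2 v (V.le_topologicalClosure hv)
      have hu : u < 0 := by simpa using hV 0 V.zero_mem
      refine ⟨L, fun h0 => ?_, fun v hv => ?_⟩
      · rw [h0] at hL1; simp at hL1; linarith
      · by_contra hv0
        -- The multiple of `v` is chosen so that `L` takes the value `u` on it, which contradicts
        -- the strict bound `u < re (L v)` on `V`.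
        have h1 := hV (((u / Complex.normSq (L v) : ℝ) * starRingEnd ℂ (L v) : ℂ) • v)
          (V.smul_mem _ hv)
        rw [map_smul, smul_eq_mul, mul_assoc, mul_comm (starRingEnd ℂ (L v)), Complex.mul_conj,
          ← Complex.ofReal_mul, div_mul_cancel₀ _ (by simpa using hv0)] at h1
        simp at h1
    obtain ⟨ν, hνm, hνb, hν⟩ := exists_bounded_integral_eq L
    have key : ∀ (g : α → ℂ) (hg : Integrable g μ), L (hg.toL1 g) = ∫ x, ν x * g x ∂μ := by
      intro g hg
      rw [hν]
      refine integral_congr_ae ?_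
      filter_upwards [hg.coeFn_toL1] with x hx
      rw [hx]
    refine hL1 ?_
    rw [key]
    refine h ν hνm ⟨_, hνb⟩ fun φ hφ => ?_
    rw [← key φ (hM φ hφ)]
    exact hL2 _ ⟨⟨φ, hφ⟩, rfl⟩
  obtain ⟨g, hg, hgd⟩ := Metric.mem_closure_iff.1 hmem ε hε
  obtain ⟨φ, rfl⟩ := hg
  refine ⟨φ, φ.2, ?_⟩
  rw [dist_comm, dist_eq_norm] at hgd
  have : T φ - hf.toL1 f = ((hM φ φ.2).sub hf).toL1 _ :=
    (Integrable.toL1_sub _ _ (hM φ φ.2) hf).symm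
  rw [this, L1.norm_of_fun_eq_integral_norm] at hgd
  exact hgd

/-- Passing to the finite measure `w μ` and replacing `φ` by `φ / w` preserves both the `L¹`
distances and the integrals against `ν`. -/
theorem exists_mem_integral_norm_sub_lt {α : Type*} [MeasurableSpace α] {μ : Measure α}
    [SigmaFinite μ] (M : Submodule ℂ (α → ℂ)) (hM : ∀ φ ∈ M, Integrable φ μ) {f : α → ℂ}
    (hf : Integrable f μ)
    (h : ∀ ν : α → ℂ, Measurable ν → (∃ C, ∀ x, ‖ν x‖ ≤ C) →
      (∀ φ ∈ M, ∫ x, ν x * φ x ∂μ = 0) → ∫ x, ν x * f x ∂μ = 0)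
    {ε : ℝ} (hε : 0 < ε) : ∃ φ ∈ M, ∫ x, ‖φ x - f x‖ ∂μ < ε := by
  obtain ⟨w, hw0, hwm, hw1⟩ := exists_pos_lintegral_lt_of_sigmaFinite μ (ε := 1) one_ne_zero
  let m := μ.withDensity fun x => (w x : ENNReal)
  have hfin : IsFiniteMeasure m := isFiniteMeasure_withDensity (hw1.trans ENNReal.one_lt_top).ne
  have hwc : ∀ x, (w x : ℂ) ≠ 0 := fun x => by exact_mod_cast (hw0 x).ne'
  let D : (α → ℂ) →ₗ[ℂ] (α → ℂ) :=
    { toFun := fun φ x => (w x : ℂ)⁻¹ * φ x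
      map_add' := fun φ ψ => by ext x; simp [mul_add]
      map_smul' := fun c φ => by ext x; simp [mul_left_comm] }
  have hD : ∀ φ x, w x • D φ x = φ x := by
    intro φ x
    change ((w x : ℝ)) • ((w x : ℂ)⁻¹ * φ x) = _
    rw [Complex.real_smul]
    exact mul_inv_cancel_left₀ (hwc x) _
  have hDint : ∀ φ, Integrable φ μ → Integrable (D φ) m := by
    intro φ hφ
    refine (integrable_withDensity_iff_integrable_smul hwm).2 ?_
    simpa only [hD] using hφ
  have hDi : ∀ (φ ν : α → ℂ), ∫ x, ν x * D φ x ∂m = ∫ x, ν x * φ x ∂μ := by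
    intro φ ν
    rw [integral_withDensity_eq_integral_smul hwm]
    refine integral_congr_ae (.of_forall fun x => ?_)
    change w x • (ν x * D φ x) = ν x * φ x
    rw [← mul_smul_comm, hD]
  obtain ⟨φ', ⟨φ, hφ, rfl⟩, hlt⟩ := exists_mem_integral_norm_sub_lt_of_finite (μ := m)
    (M.map D) (by rintro _ ⟨φ, hφ, rfl⟩; exact hDint φ (hM φ hφ)) (hDint f hf) (by
      intro ν hν hb hann
      rw [hDi]
      refine h ν hν hb fun φ hφ => ?_
      rw [← hDi]
      exact hann _ ⟨φ, hφ, rfl⟩) hε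
  refine ⟨φ, hφ, ?_⟩
  rw [integral_withDensity_eq_integral_smul hwm] at hlt
  convert hlt using 2
  ext x
  conv_lhs => rw [← hD φ x, ← hD f x, ← smul_sub]
  rw [NNReal.smul_def, norm_smul]
  simp [NNReal.smul_def]

/-! ### Cauchy kernels and Cauchy transforms. -/

theorem locallyIntegrable_sub_inv (a : ℂ) :
    LocallyIntegrable (fun z : ℂ => (z - a)⁻¹) volume := by
  have h0 : LocallyIntegrable (fun z : ℂ => z⁻¹) volume := by
    refine locallyIntegrable_of_norm_le_rpow (C := 1) (α := 1) (by simp) (by simp)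
      (.of_forall fun z => ?_) measurable_inv.aestronglyMeasurable
    rw [norm_inv, Real.rpow_neg_one, one_mul]
  rw [locallyIntegrable_iff] at h0 ⊢
  intro k hk
  have h1 := h0 _ (hk.image (continuous_sub_right a))
  exact ((measurePreserving_sub_right volume a).integrableOn_image
    (MeasurableEquiv.subRight a).measurableEmbedding).1 h1

/-- Partial fractions give local integrability. Three poles are needed at infinity: decay of order
`|z|⁻³` is integrable in the plane, `|z|⁻²` is not. -/
theorem integrable_three_poles {a b c : ℂ} (hab : a ≠ b) (hac : a ≠ c) (hbc : b ≠ c) :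
    Integrable (fun z : ℂ => ((z - a) * (z - b) * (z - c))⁻¹) volume := by
  have hm : Measurable (fun z : ℂ => ((z - a) * (z - b) * (z - c))⁻¹) := by fun_prop
  have hloc : LocallyIntegrable (fun z : ℂ => ((z - a) * (z - b) * (z - c))⁻¹) volume := by
    have hA : ∀ k x : ℂ, LocallyIntegrable (fun z : ℂ => k * (z - x)⁻¹) volume :=
      fun k x => (locallyIntegrable_sub_inv x).smul k
    have h1 := ((hA ((a - b) * (a - c))⁻¹ a).add (hA ((b - a) * (b - c))⁻¹ b)).add
      (hA ((c - a) * (c - b))⁻¹ c)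
    refine h1.congr ?_
    have hne : ∀ x : ℂ, ∀ᵐ z : ℂ, z ≠ x := fun x => by
      simp [ae_iff]
    filter_upwards [hne a, hne b, hne c] with z ha hb hc
    have h1 := sub_ne_zero.2 ha
    have h2 := sub_ne_zero.2 hb
    have h3 := sub_ne_zero.2 hc
    have h4 := sub_ne_zero.2 hab
    have h5 := sub_ne_zero.2 hac
    have h6 := sub_ne_zero.2 hbc
    have h4' := sub_ne_zero.2 hab.symm
    have h5' := sub_ne_zero.2 hac.symm
    have h6' := sub_ne_zero.2 hbc.symm
    simp only [Pi.add_apply]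
    rw [← neg_sub a b, ← neg_sub a c, ← neg_sub b c] at *
    field_simp
    ring
  -- For `|z| > R` each factor is at least `(1 + |z|) / 4`, whence the constant `64 = 4³` below.
  let R := 2 * (‖a‖ + ‖b‖ + ‖c‖) + 1
  rw [← integrableOn_univ, ← Set.union_compl_self (Metric.closedBall (0 : ℂ) R)]
  refine IntegrableOn.union (hloc.integrableOn_isCompact (isCompact_closedBall _ _)) ?_
  have hJ : Integrable (fun z : ℂ => 64 * (1 + ‖z‖) ^ (-(3 : ℝ))) volume :=
    (integrable_one_add_norm (by simp; norm_num)).const_mul _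
  refine Integrable.mono' hJ.integrableOn hm.aestronglyMeasurable ?_
  refine (ae_restrict_iff' Metric.isClosed_closedBall.measurableSet.compl).2
    (.of_forall fun z hz => ?_)
  have hz' : R < ‖z‖ := by simpa using hz
  have hR1 : R = 2 * (‖a‖ + ‖b‖ + ‖c‖) + 1 := rfl
  have key : ∀ x : ℂ, ‖x‖ ≤ ‖a‖ + ‖b‖ + ‖c‖ → (1 + ‖z‖) / 4 ≤ ‖z - x‖ := by
    intro x hx
    have := norm_sub_norm_le z x
    have := norm_nonneg a; have := norm_nonneg b; have := norm_nonneg c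
    linarith
  have ka := key a (by linarith [norm_nonneg b, norm_nonneg c])
  have kb := key b (by linarith [norm_nonneg a, norm_nonneg c])
  have kc := key c (by linarith [norm_nonneg b, norm_nonneg a])
  have hp : 0 < (1 + ‖z‖) / 4 := by positivity
  rw [norm_inv, norm_mul, norm_mul, Real.rpow_neg (by positivity)]
  norm_cast
  calc (‖z - a‖ * ‖z - b‖ * ‖z - c‖)⁻¹
      ≤ ((1 + ‖z‖) / 4 * ((1 + ‖z‖) / 4) * ((1 + ‖z‖) / 4))⁻¹ := by gcongr
    _ = _ := by field_simp; norm_num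

/-- Integrals of `g / (p - w q)` are holomorphic in `w` as long as the denominator stays away from
zero on the support of `g`. -/
theorem differentiableOn_integral_div {α : Type*} [MeasurableSpace α] {m : Measure α}
    {g p q : α → ℂ} (hg : Integrable g m) (hp : Measurable p) (hq : Measurable q)
    {U : Set ℂ} (hU : IsOpen U) {δ C : ℝ} (hδ : 0 < δ)
    (h : ∀ x, g x ≠ 0 → ‖q x‖ ≤ C ∧ ∀ w ∈ U, δ ≤ ‖p x - w * q x‖) :
    DifferentiableOn ℂ (fun w => ∫ x, g x / (p x - w * q x) ∂m) U := by
  intro w₀ hw₀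
  have hmeas : ∀ w : ℂ, AEStronglyMeasurable (fun x => g x / (p x - w * q x)) m := fun w =>
    (hg.1.aemeasurable.div (by fun_prop)).aestronglyMeasurable
  have hle : ∀ w ∈ U, ∀ x, ‖g x / (p x - w * q x)‖ ≤ δ⁻¹ * ‖g x‖ := by
    intro w hw x
    by_cases hx : g x = 0
    · simp [hx]
    · rw [norm_div, div_eq_inv_mul]
      gcongr
      exact (h x hx).2 w hw
  have := hasDerivAt_integral_of_dominated_loc_of_deriv_le (μ := m) (𝕜 := ℂ)
    (F := fun w x => g x / (p x - w * q x))
    (F' := fun w x => g x * q x / (p x - w * q x) ^ 2) (bound := fun x => C * δ⁻¹ ^ 2 * ‖g x‖)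
    (hU.mem_nhds hw₀) (.of_forall hmeas)
    ((hg.norm.const_mul δ⁻¹).mono' (hmeas w₀) (.of_forall fun x => hle w₀ hw₀ x))
    (((hg.1.aemeasurable.mul hq.aemeasurable).div (by fun_prop)).aestronglyMeasurable)
    (.of_forall fun x w hw => ?_) (hg.norm.const_mul _) (.of_forall fun x w hw => ?_)
  · exact this.2.differentiableAt.differentiableWithinAt
  · by_cases hx : g x = 0
    · simp [hx]
    · obtain ⟨h1, h2⟩ := h x hx
      have h3 := h2 w hw
      rw [norm_div, norm_mul, norm_pow]
      calc ‖g x‖ * ‖q x‖ / ‖p x - w * q x‖ ^ 2 ≤ ‖g x‖ * C / δ ^ 2 := by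
            have := (norm_nonneg _).trans h1
            gcongr
        _ = _ := by rw [inv_pow]; ring
  · by_cases hx : g x = 0
    · simpa [hx] using hasDerivAt_const w (0 : ℂ)
    · have h3 := (h x hx).2 w hw
      have hne : p x - w * q x ≠ 0 := norm_pos_iff.1 (hδ.trans_le h3)
      have h4 : HasDerivAt (fun w => p x - w * q x) (-q x) w := by
        simpa using ((hasDerivAt_id w).mul_const (q x)).const_sub (p x)
      have h5 := (h4.inv hne).const_mul (g x)
      simp only [div_eq_mul_inv]
      refine HasDerivAt.congr_deriv (f := fun w => g x * (p x - w * q x)⁻¹) h5 ?_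
      rw [neg_neg]; ring

/-- The Cauchy transform of `g`. -/
noncomputable def cauchy (g : ℂ → ℂ) (w : ℂ) : ℂ := ∫ z, g z / (z - w)

theorem cauchy_differentiableOn {g : ℂ → ℂ} (hg : Integrable g) {O : Set ℂ} (hO : IsOpen O)
    (h0 : ∀ z ∈ O, g z = 0) : DifferentiableOn ℂ (cauchy g) O := by
  intro w hw
  obtain ⟨δ, hδ, hsub⟩ := Metric.isOpen_iff.1 hO w hw
  have := differentiableOn_integral_div (p := fun z => z) (q := fun _ => 1) hg measurable_id
    measurable_const (U := Metric.ball w (δ / 2)) Metric.isOpen_ball (C := 1) (half_pos hδ)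
    (fun z hz => ⟨by simp, fun v hv => ?_⟩)
  · simp only [mul_one] at this
    exact (this.differentiableAt (Metric.ball_mem_nhds w (half_pos hδ))).differentiableWithinAt
  · have h1 : δ ≤ dist z w := by
      by_contra hcon
      exact hz (h0 z (hsub (not_le.1 hcon)))
    have h2 : dist v w < δ / 2 := hv
    have h3 := dist_triangle z v w
    rw [mul_one, ← dist_eq_norm]
    linarith

/-- If `g` vanishes near infinity and its Cauchy transform has zeros accumulating at infinity,
then the Cauchy transform vanishes near infinity. -/
theorem cauchy_eq_zero_of_unbounded {g : ℂ → ℂ} (hg : Integrable g) {R : ℝ} (hR : 0 < R)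
    (h0 : ∀ z, R < ‖z‖ → g z = 0) (hz : ∀ r : ℝ, ∃ w : ℂ, r < ‖w‖ ∧ cauchy g w = 0) :
    ∀ w : ℂ, 2 * R < ‖w‖ → cauchy g w = 0 := by
  -- The substitution `w = 1 / ζ` moves infinity to 0, where `G` is holomorphic and its zeros
  -- accumulate.
  let G : ℂ → ℂ := fun ζ => ∫ z, g z / (1 - ζ * z)
  have hG : ∀ w : ℂ, w ≠ 0 → G w⁻¹ = -w * cauchy g w := by
    intro w hw
    simp only [G, cauchy]
    rw [← integral_const_mul]
    congr 1 with z
    -- At `z = w` both denominators vanish, and both quotients are 0 by the convention for division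
    -- by zero.
    by_cases hzw : z = w
    · subst hzw; simp [hw]
    have h1 : z - w ≠ 0 := sub_ne_zero.2 hzw
    have h2 : 1 - w⁻¹ * z ≠ 0 := by
      intro h
      apply h1
      field_simp at h
      linear_combination -h
    rw [← mul_div_assoc, div_eq_div_iff h2 h1]
    field_simp
    ring
  have hU : DifferentiableOn ℂ G (Metric.ball 0 (2 * R)⁻¹) := by
    refine differentiableOn_integral_div (p := fun _ => 1) (q := fun z => z) hg measurable_const
      measurable_id Metric.isOpen_ball (C := R) one_half_pos (fun z hz => ?_)
    have hzR : ‖z‖ ≤ R := by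
      by_contra hcon
      exact hz (h0 z (not_le.1 hcon))
    refine ⟨hzR, fun w hw => ?_⟩
    have h1 : ‖w‖ < (2 * R)⁻¹ := by simpa using hw
    have h2 : ‖w * z‖ ≤ 1 / 2 := by
      rw [norm_mul]
      calc ‖w‖ * ‖z‖ ≤ (2 * R)⁻¹ * R := by gcongr
        _ = 1 / 2 := by field_simp
    have h3 := norm_sub_norm_le (1 : ℂ) (w * z)
    rw [norm_one] at h3
    linarith
  have hmem : (0 : ℂ) ∈ Metric.ball (0 : ℂ) (2 * R)⁻¹ := Metric.mem_ball_self (by positivity)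
  have hfreq : ∃ᶠ ζ in nhdsWithin (0 : ℂ) {0}ᶜ, G ζ = 0 := by
    rw [Metric.nhdsWithin_basis_ball.frequently_iff]
    intro ε hε
    obtain ⟨w, hw, hw0⟩ := hz ε⁻¹
    have hwne : w ≠ 0 := norm_pos_iff.1 ((inv_pos.2 hε).trans hw)
    refine ⟨w⁻¹, ⟨?_, by simpa using hwne⟩, by rw [hG w hwne, hw0, mul_zero]⟩
    rw [mem_ball_zero_iff, norm_inv]
    exact inv_lt_of_inv_lt₀ hε hw
  have hzero := (hU.analyticOnNhd Metric.isOpen_ball).eqOn_zero_of_preconnected_of_frequently_eq_zero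
    (convex_ball _ _).isPreconnected hmem hfreq
  intro w hw
  have hwne : w ≠ 0 := norm_pos_iff.1 (by linarith)
  have h1 : G w⁻¹ = 0 := hzero (by
    rw [mem_ball_zero_iff, norm_inv]
    exact inv_strictAnti₀ (by positivity) hw)
  rw [hG w hwne] at h1
  simpa [hwne] using h1

/-- If the Cauchy transform of `g` vanishes on a circle near which `g` vanishes, then the integral
of `g` over the disc is zero. -/
theorem setIntegral_ball_eq_zero {g : ℂ → ℂ} (hg : Integrable g) (hgm : Measurable g)
    {O : Set ℂ} (hO : IsOpen O) (h0 : ∀ z ∈ O, g z = 0) {q : ℂ} {ρ : ℝ} (hρ : 0 < ρ)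
    (hsub : Metric.sphere q ρ ⊆ O) (hF : ∀ w ∈ Metric.sphere q ρ, cauchy g w = 0) :
    ∫ z in Metric.ball q ρ, g z = 0 := by
  obtain ⟨δ, hδ, hthick⟩ := (isCompact_sphere q ρ).exists_thickening_subset_open hO hsub
  have hdist : ∀ z, g z ≠ 0 → ∀ w ∈ Metric.sphere q ρ, δ ≤ ‖z - w‖ := by
    intro z hz w hw
    by_contra hcon
    refine hz (h0 z (hthick (Metric.mem_thickening_iff.2 ⟨w, hw, ?_⟩)))
    rw [dist_eq_norm]; exact not_le.1 hcon
  have hsph : ∀ θ, circleMap q ρ θ ∈ Metric.sphere q ρ := fun θ => circleMap_mem_sphere q hρ.le θ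
  have h1 : (∮ w in C(q, ρ), cauchy g w) = 0 := by
    rw [circleIntegral.integral_congr hρ.le (g := fun _ => 0) hF]
    simp [circleIntegral]
  have hint : Integrable (Function.uncurry fun (θ : ℝ) (z : ℂ) =>
      deriv (circleMap q ρ) θ • (g z / (z - circleMap q ρ θ)))
      ((volume.restrict (Set.Ioc 0 (2 * Real.pi))).prod volume) := by
    have hb : Integrable (fun x : ℝ × ℂ => (ρ * δ⁻¹) * ‖g x.2‖)
        ((volume.restrict (Set.Ioc 0 (2 * Real.pi))).prod volume) :=
      (integrable_const (ρ * δ⁻¹)).mul_prod hg.norm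
    refine hb.mono' ?_ (.of_forall fun x => ?_)
    · refine Measurable.aestronglyMeasurable ?_
      simp only [deriv_circleMap, Function.uncurry_def]
      have hc : ∀ c, Measurable (circleMap c ρ) := fun c => (continuous_circleMap c ρ).measurable
      exact (((hc 0).comp measurable_fst).mul_const _).smul
        ((hgm.comp measurable_snd).div (measurable_snd.sub ((hc q).comp measurable_fst)))
    · simp only [Function.uncurry_def]
      by_cases hx : g x.2 = 0
      · simp [hx]
      · rw [norm_smul, deriv_circleMap, norm_mul, norm_circleMap_zero, Complex.norm_I, mul_one,
          abs_of_pos hρ, norm_div, mul_assoc, div_eq_inv_mul]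
        gcongr
        exact hdist _ hx _ (hsph _)
  rw [circleIntegral, intervalIntegral.integral_of_le (by positivity)] at h1
  simp only [cauchy, ← integral_smul] at h1
  rw [integral_integral_swap hint] at h1
  -- After Fubini, the inner integral over the circle is a winding number: it picks out the points
  -- inside the disc. Points on the circle do not matter, since `g` vanishes there.
  have h2 : ∀ z, ∫ θ in Set.Ioc 0 (2 * Real.pi),
      deriv (circleMap q ρ) θ • (g z / (z - circleMap q ρ θ)) =
      -(2 * Real.pi * Complex.I) * (Metric.ball q ρ).indicator g z := by
    intro z
    by_cases hz : g z = 0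
    · simp [hz, Set.indicator]
    have h3 : ∫ θ in Set.Ioc 0 (2 * Real.pi),
        deriv (circleMap q ρ) θ • (g z / (z - circleMap q ρ θ)) =
        -g z * ∮ w in C(q, ρ), (w - z)⁻¹ := by
      rw [circleIntegral, intervalIntegral.integral_of_le (by positivity), ← integral_const_mul]
      congr 1 with θ
      rw [← neg_sub (circleMap q ρ θ) z, div_neg, smul_eq_mul, smul_eq_mul, div_eq_mul_inv]
      ring
    rw [h3]
    by_cases hzb : z ∈ Metric.ball q ρ
    · rw [circleIntegral.integral_sub_inv_of_mem_ball hzb, Set.indicator_of_mem hzb]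
      ring
    · have hzc : z ∉ Metric.closedBall q ρ := by
        rw [← Metric.ball_union_sphere]
        rintro (h | h)
        · exact hzb h
        · exact hz (h0 z (hsub h))
      rw [Set.indicator_of_notMem hzb, Complex.circleIntegral_eq_zero_of_differentiable_on_off_countable
        hρ.le Set.countable_empty]
      · simp
      · refine ContinuousOn.inv₀ (by fun_prop) fun w hw h => hzc ?_
        rwa [← sub_eq_zero.1 h]
      · rintro w ⟨hw, -⟩
        refine DifferentiableAt.inv (by fun_prop) fun h => hzc ?_
        rw [← sub_eq_zero.1 h]
        exact Metric.ball_subset_closedBall hw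
  simp only [h2] at h1
  rw [integral_const_mul, integral_indicator measurableSet_ball] at h1
  simpa [Real.pi_ne_zero] using h1

/-- An integrable function whose integral over small discs with centres in a dense sequence
vanishes is zero almost everywhere. -/
theorem ae_eq_zero_of_setIntegral_ball {g : ℂ → ℂ} (hg : Integrable g) {Δ : Set ℂ}
    (hΔ : IsOpen Δ) {d : ℕ → ℂ} (hd : DenseRange d)
    (h : ∀ i n : ℕ, Metric.closedBall (d i) (1 / ((n : ℝ) + 1)) ⊆ Δ →
      ∫ z in Metric.ball (d i) (1 / ((n : ℝ) + 1)), g z = 0) :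
    ∀ᵐ z, z ∈ Δ → g z = 0 := by
  -- Lebesgue differentiation in a form that allows discs containing `z` without being centred at
  -- `z`.
  filter_upwards [IsUnifLocDoublingMeasure.ae_tendsto_average volume hg.locallyIntegrable 1] with
    z hz hzΔ
  have hex : ∀ n : ℕ, ∃ i, dist z (d i) < 1 / ((n : ℝ) + 1) := fun n =>
    hd.exists_dist_lt z (by positivity)
  choose i hi using hex
  have hlim : Filter.Tendsto (fun n : ℕ => 1 / ((n : ℝ) + 1)) Filter.atTop
      (nhdsWithin 0 (Set.Ioi 0)) :=
    tendsto_nhdsWithin_iff.2 ⟨tendsto_one_div_add_atTop_nhds_zero_nat,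
      .of_forall fun n => by simp only [Set.mem_Ioi]; positivity⟩
  have h1 := hz (fun n => d (i n)) _ hlim (.of_forall fun n => by
    rw [one_mul]; exact (hi n).le)
  obtain ⟨ε, hε, hball⟩ := Metric.isOpen_iff.1 hΔ z hzΔ
  refine tendsto_nhds_unique h1 (tendsto_const_nhds.congr' ?_)
  have h2 : ∀ᶠ n : ℕ in Filter.atTop, 1 / ((n : ℝ) + 1) < ε / 2 :=
    tendsto_one_div_add_atTop_nhds_zero_nat.eventually (gt_mem_nhds (half_pos hε))
  filter_upwards [h2] with n hn
  have h3 : ∫ y in Metric.closedBall (d (i n)) (1 / ((n : ℝ) + 1)), g y = 0 := by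
    have hsub : Metric.closedBall (d (i n)) (1 / ((n : ℝ) + 1)) ⊆ Δ := by
      refine Set.Subset.trans (fun y hy => ?_) hball
      rw [Metric.mem_closedBall] at hy
      rw [Metric.mem_ball]
      have := dist_triangle_right y z (d (i n))
      linarith [hi n]
    rw [← Metric.ball_union_sphere, setIntegral_congr_set (union_ae_eq_left_of_ae_eq_empty
      (ae_eq_empty.2 (Measure.addHaar_sphere _ _ _)))]
    exact h _ _ hsub
  rw [setAverage_eq, h3, smul_zero]

/-! ### Determining sets of small measure. -/

/-- An open set `O` is determining for `W` and `Δ` if every integrable function that vanishes on `O`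
and whose Cauchy transform vanishes on `W` is zero almost everywhere on `Δ`. -/
def IsDetermining (W Δ O : Set ℂ) : Prop :=
  IsOpen O ∧ ∀ g : ℂ → ℂ, Measurable g → Integrable g → (∀ z ∈ O, g z = 0) →
    (∀ w ∈ W, cauchy g w = 0) → ∀ᵐ z, z ∈ Δ → g z = 0

/-- The circle with diameter `[x, y]`. -/
def diamSphere (x y : ℂ) : Set ℂ := Metric.sphere ((x + y) / 2) (‖x - y‖ / 2)

theorem left_mem_diamSphere (x y : ℂ) : x ∈ diamSphere x y := by
  have : x - (x + y) / 2 = (x - y) / 2 := by ring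
  rw [diamSphere, mem_sphere_iff_norm, this, norm_div]
  norm_num

theorem right_mem_diamSphere (x y : ℂ) : y ∈ diamSphere x y := by
  have : y - (x + y) / 2 = -((x - y) / 2) := by ring
  rw [diamSphere, mem_sphere_iff_norm, this, norm_neg, norm_div]
  norm_num

theorem isPreconnected_sphere_complex (x : ℂ) (r : ℝ) : IsPreconnected (Metric.sphere x r) :=
  isPreconnected_sphere (by simp [Complex.rank_real_complex]) x r

/-- Each small circle is joined to the anchor `p` through two circles with diameters `[p, x₀]` and
`[x₀, y]`, with `y` on the small circle. The Cauchy transform is analytic along this connected chain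
and zero near `p`, hence zero on the small circle. -/
theorem isDetermining_of_circles {W Δ O : Set ℂ} (hΔ : IsOpen Δ) (hO : IsOpen O) {d : ℕ → ℂ}
    (hd : DenseRange d) {p x₀ : ℂ} (hpx : diamSphere p x₀ ⊆ O)
    (hsub : ∀ i n : ℕ, Metric.closedBall (d i) (1 / ((n : ℝ) + 1)) ⊆ Δ →
      diamSphere x₀ (d i + (1 / ((n : ℝ) + 1) : ℝ)) ⊆ O ∧
        Metric.sphere (d i) (1 / ((n : ℝ) + 1)) ⊆ O)
    (hp : ∀ g : ℂ → ℂ, Integrable g → (∀ z ∈ O, g z = 0) →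
      (∀ w ∈ W, cauchy g w = 0) → cauchy g =ᶠ[nhds p] 0) :
    IsDetermining W Δ O := by
  refine ⟨hO, fun g hgm hg h0 hW => ae_eq_zero_of_setIntegral_ball hg hΔ hd fun i n hin => ?_⟩
  obtain ⟨h1, h2⟩ := hsub i n hin
  have hρ : (0 : ℝ) < 1 / ((n : ℝ) + 1) := by positivity
  set ρ : ℝ := 1 / ((n : ℝ) + 1)
  have hy : d i + (ρ : ℂ) ∈ Metric.sphere (d i) ρ := by
    simp [hρ.le]
  have hconn : IsPreconnected (diamSphere p x₀ ∪ diamSphere x₀ (d i + ρ) ∪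
      Metric.sphere (d i) ρ) :=
    ((isPreconnected_sphere_complex _ _).union x₀ (right_mem_diamSphere _ _)
      (left_mem_diamSphere _ _) (isPreconnected_sphere_complex _ _)).union _
      (.inr (right_mem_diamSphere _ _)) hy (isPreconnected_sphere_complex _ _)
  have han : AnalyticOnNhd ℂ (cauchy g) O :=
    (cauchy_differentiableOn hg hO h0).analyticOnNhd hO
  have hz := (han.mono (Set.union_subset (Set.union_subset hpx h1) h2))
    |>.eqOn_zero_of_preconnected_of_eventuallyEq_zero hconn
      (.inl (.inl (left_mem_diamSphere p x₀))) (hp g hg h0 hW)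
  exact setIntegral_ball_eq_zero hg hgm hO h0 hρ h2 fun w hw => hz (.inr hw)

/-- A countable union of circles is a null set, so it has neighbourhoods of arbitrarily small
measure. The excluded disc lies on the opposite side of `x₀` from the anchor `x₀ + t u`, so the
large circle through both points misses it. The extra set `V` is there for the case of an anchor
near infinity. -/
theorem exists_isDetermining_of_anchor {W V : Set ℂ} {x₀ u : ℂ} {r t : ℝ} (hr : 0 < r)
    (hu : ‖u‖ = 1) (ht : 0 < t) (hV : IsOpen V)
    (hVd : Disjoint V (Metric.closedBall (x₀ - 2 * r * u) (r / 2)))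
    (hp : ∀ O : Set ℂ, IsOpen O → V ⊆ O → x₀ + t * u ∈ O → ∀ g : ℂ → ℂ, Integrable g →
      (∀ z ∈ O, g z = 0) → (∀ w ∈ W, cauchy g w = 0) → cauchy g =ᶠ[nhds (x₀ + t * u)] 0)
    {m : Measure ℂ} [IsFiniteMeasure m] (hm : m ≪ volume) {ε : ENNReal} (hmV : m V < ε) :
    ∃ O, IsDetermining W (Metric.ball x₀ r) O ∧ m O < ε ∧
      Disjoint O (Metric.closedBall (x₀ - 2 * r * u) (r / 2)) ∧
      ∀ E : Set ℂ, IsOpen E → (E ∩ Metric.ball x₀ r).Nonempty → (E ∩ O).Nonempty := by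
  set B := Metric.closedBall (x₀ - 2 * r * u) (r / 2) with hB
  set p := x₀ + t * u with hpdef
  obtain ⟨d, hd⟩ := TopologicalSpace.exists_dense_seq ℂ
  let I := {x : ℕ × ℕ | Metric.closedBall (d x.1) (1 / ((x.2 : ℝ) + 1)) ⊆ Metric.ball x₀ r}
  let T := diamSphere p x₀ ∪ ⋃ x ∈ I, (diamSphere x₀ (d x.1 + (1 / ((x.2 : ℝ) + 1) : ℝ)) ∪
        Metric.sphere (d x.1) (1 / ((x.2 : ℝ) + 1)))
  have hTm : m T = 0 := by
    refine hm ?_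
    refine measure_union_null (Measure.addHaar_sphere _ _ _)
      ((measure_biUnion_null_iff I.to_countable).2 fun x _ =>
        measure_union_null (Measure.addHaar_sphere _ _ _) (Measure.addHaar_sphere _ _ _))
  have hnear : ∀ z, dist z x₀ < r → z ∉ B := by
    intro z hz hzB
    have h1 : dist x₀ (x₀ - 2 * r * u) = 2 * r := by
      rw [dist_eq_norm, sub_sub_cancel, norm_mul, norm_mul, hu]
      simp [abs_of_pos hr]
    have h2 := dist_triangle_left x₀ (x₀ - 2 * r * u) z
    rw [hB, Metric.mem_closedBall] at hzB
    linarith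
  have hTB : T ⊆ Bᶜ := by
    rintro z (hz | hz)
    · intro hzB
      rw [hB, mem_closedBall_iff_norm] at hzB
      rw [diamSphere, mem_sphere_iff_norm] at hz
      have h1 : p - x₀ = t * u := by rw [hpdef]; ring
      have h2 : ((t / 2 + 2 * r : ℝ) : ℂ) * u =
          (z - (x₀ - 2 * r * u)) - (z - (p + x₀) / 2) := by
        rw [hpdef]; push_cast; ring
      have h3 : ‖((t / 2 + 2 * r : ℝ) : ℂ) * u‖ = t / 2 + 2 * r := by
        rw [norm_mul, hu, mul_one, Complex.norm_real, Real.norm_of_nonneg (by positivity)]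
      have h4 := norm_sub_le (z - (x₀ - 2 * r * u)) (z - (p + x₀) / 2)
      rw [← h2, h3, hz, h1, norm_mul, hu, Complex.norm_real, Real.norm_of_nonneg ht.le] at h4
      linarith
    · simp only [Set.mem_iUnion] at hz
      obtain ⟨x, hx, hz | hz⟩ := hz
      · refine hnear z ?_
        set y : ℂ := d x.1 + (1 / ((x.2 : ℝ) + 1) : ℝ)
        have hy : y ∈ Metric.ball x₀ r := hx (by
          rw [mem_closedBall_iff_norm, add_sub_cancel_left, Complex.norm_real,
            Real.norm_of_nonneg (by positivity)])
        rw [mem_ball_iff_norm] at hy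
        rw [diamSphere, mem_sphere_iff_norm] at hz
        have h1 : z - x₀ = (z - (x₀ + y) / 2) + (y - x₀) / 2 := by ring
        rw [dist_eq_norm, h1]
        refine (norm_add_le _ _).trans_lt ?_
        rw [hz, norm_div, norm_sub_rev x₀ y]
        norm_num
        linarith
      · exact hnear z (hx (Metric.sphere_subset_closedBall hz))
  obtain ⟨O', hTO', hO', hmO'⟩ := T.exists_isOpen_lt_of_lt (μ := m) (ε - m V)
    (by rw [hTm]; exact tsub_pos_of_lt hmV)
  let O := V ∪ (O' ∩ Bᶜ)
  have hO : IsOpen O := hV.union (hO'.inter Metric.isClosed_closedBall.isOpen_compl)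
  have hTO : T ⊆ O := fun z hz => .inr ⟨hTO' hz, hTB hz⟩
  have hTO2 : ∀ i n : ℕ, Metric.closedBall (d i) (1 / ((n : ℝ) + 1)) ⊆ Metric.ball x₀ r →
      diamSphere x₀ (d i + (1 / ((n : ℝ) + 1) : ℝ)) ⊆ O ∧
        Metric.sphere (d i) (1 / ((n : ℝ) + 1)) ⊆ O := by
    intro i n hin
    have hT : diamSphere x₀ (d i + (1 / ((n : ℝ) + 1) : ℝ)) ∪
        Metric.sphere (d i) (1 / ((n : ℝ) + 1)) ⊆ T :=
      (Set.subset_biUnion_of_mem (u := fun x : ℕ × ℕ =>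
        (diamSphere x₀ (d x.1 + (1 / ((x.2 : ℝ) + 1) : ℝ)) ∪
        Metric.sphere (d x.1) (1 / ((x.2 : ℝ) + 1)))) (show (i, n) ∈ I from hin)).trans
        Set.subset_union_right
    exact Set.union_subset_iff.1 (hT.trans hTO)
  refine ⟨O, isDetermining_of_circles Metric.isOpen_ball hO hd
    (Set.subset_union_left.trans hTO) hTO2 (hp O hO Set.subset_union_left
      (hTO (.inl (left_mem_diamSphere _ _)))), ?_, ?_, ?_⟩
  · calc m O ≤ m V + m (O' ∩ Bᶜ) := measure_union_le _ _
      _ ≤ m V + m O' := by gcongr; exact Set.inter_subset_left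
      _ < m V + (ε - m V) := by
        exact ENNReal.add_lt_add_left (measure_ne_top _ _) hmO'
      _ = ε := add_tsub_cancel_of_le hmV.le
  · exact Set.disjoint_union_left.2 ⟨hVd, Set.disjoint_left.2 fun z hz => hz.2⟩
  -- An open set that meets the disc contains an entire small circle of the net.
  · rintro E hE ⟨z, hz⟩
    obtain ⟨δ, hδ, hball⟩ := Metric.isOpen_iff.1 (hE.inter Metric.isOpen_ball) z hz
    obtain ⟨n, hn⟩ := exists_nat_one_div_lt (half_pos hδ)
    obtain ⟨i, hi⟩ := hd.exists_dist_lt z (show (0 : ℝ) < 1 / ((n : ℝ) + 1) by positivity)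
    have hsub : Metric.closedBall (d i) (1 / ((n : ℝ) + 1)) ⊆ E ∩ Metric.ball x₀ r := by
      refine Set.Subset.trans (fun y hy => ?_) hball
      rw [Metric.mem_closedBall] at hy
      rw [Metric.mem_ball]
      have := dist_triangle_right y z (d i)
      linarith
    have hy : d i + (1 / ((n : ℝ) + 1) : ℝ) ∈ Metric.sphere (d i) (1 / ((n : ℝ) + 1)) := by
      rw [mem_sphere_iff_norm, add_sub_cancel_left, Complex.norm_real,
            Real.norm_of_nonneg (by positivity)]
    exact ⟨_, (hsub (Metric.sphere_subset_closedBall hy)).1,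
      (hTO2 i n (hsub.trans Set.inter_subset_right)).2 hy⟩

/-- The anchor is a finite accumulation point of `W` if `W` is bounded, and a point near infinity
otherwise. The disc about `y₀` is fixed before `m` and `ε`, so that a single disc is avoided by all
the sets `O` used later. -/
theorem exists_isDetermining {S W : Set ℂ} (hS : IsOpen S) (hWS : W ⊆ Sᶜ) (hW : W.Infinite)
    {x₀ : ℂ} {r : ℝ} (hr : 0 < r) (hball : Metric.ball x₀ (3 * r) ⊆ S) :
    ∃ (y₀ : ℂ) (s : ℝ), 0 < s ∧ Metric.closedBall y₀ s ⊆ S ∧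
      Disjoint (Metric.closedBall y₀ s) (Metric.ball x₀ r) ∧
      ∀ (m : Measure ℂ) [IsFiniteMeasure m], m ≪ volume → ∀ ε : ENNReal, 0 < ε →
        ∃ O, IsDetermining W (Metric.ball x₀ r) O ∧ m O < ε ∧
          Disjoint O (Metric.closedBall y₀ s) ∧
          ∀ E : Set ℂ, IsOpen E → (E ∩ Metric.ball x₀ r).Nonempty → (E ∩ O).Nonempty := by
  have hgeom : ∀ u : ℂ, ‖u‖ = 1 → Metric.closedBall (x₀ - 2 * r * u) (r / 2) ⊆ S ∧
      Disjoint (Metric.closedBall (x₀ - 2 * r * u) (r / 2)) (Metric.ball x₀ r) := by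
    intro u hu
    have h1 : dist (x₀ - 2 * r * u) x₀ = 2 * r := by
      rw [dist_comm, dist_eq_norm, sub_sub_cancel, norm_mul, norm_mul, hu]
      simp [abs_of_pos hr]
    refine ⟨fun z hz => hball ?_, Set.disjoint_left.2 fun z hz hz2 => ?_⟩
    · rw [Metric.mem_closedBall] at hz
      rw [Metric.mem_ball]
      have := dist_triangle z (x₀ - 2 * r * u) x₀
      linarith
    · rw [Metric.mem_closedBall] at hz
      rw [Metric.mem_ball] at hz2
      have := dist_triangle_left (x₀ - 2 * r * u) x₀ z
      linarith
  have hx₀ : x₀ ∈ S := hball (Metric.mem_ball_self (by positivity))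
  by_cases hb : Bornology.IsBounded W
  · obtain ⟨p, hpW, hp⟩ := hW.exists_accPt_of_subset_isCompact hb.isCompact_closure subset_closure
    have hpS : p ∉ S := closure_minimal hWS hS.isClosed_compl hpW
    have hne : p - x₀ ≠ 0 := sub_ne_zero.2 fun h => hpS (h ▸ hx₀)
    have ht : 0 < ‖p - x₀‖ := norm_pos_iff.2 hne
    have htc : (‖p - x₀‖ : ℂ) ≠ 0 := by exact_mod_cast ht.ne'
    let u : ℂ := (p - x₀) / ‖p - x₀‖
    have hu : ‖u‖ = 1 := by simp [u, ht.ne']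
    have hpu : x₀ + ‖p - x₀‖ * u = p := by
      simp only [u]; rw [mul_div_cancel₀ _ htc]; ring
    refine ⟨x₀ - 2 * r * u, r / 2, half_pos hr, (hgeom u hu).1, (hgeom u hu).2, ?_⟩
    intro m _ hm ε hε
    refine exists_isDetermining_of_anchor (V := ∅) (t := ‖p - x₀‖) hr hu ht isOpen_empty
      (Set.empty_disjoint _) ?_ hm (by simpa using hε)
    rw [hpu]
    intro O hO _ hpO g hg h0 hWz
    have han : AnalyticAt ℂ (cauchy g) p :=
      (cauchy_differentiableOn hg hO h0).analyticAt (hO.mem_nhds hpO)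
    refine han.frequently_zero_iff_eventually_zero.1 ?_
    exact (accPt_iff_frequently_nhdsNE.1 hp).mono hWz
  · have hunb : ∀ R : ℝ, ∃ w ∈ W, R < ‖w‖ := by
      intro R
      by_contra! hcon
      exact hb (isBounded_iff_forall_norm_le.2 ⟨R, hcon⟩)
    have hu : ‖(1 : ℂ)‖ = 1 := norm_one
    refine ⟨x₀ - 2 * r * 1, r / 2, half_pos hr, (hgeom 1 hu).1, (hgeom 1 hu).2, ?_⟩
    intro m _ hm ε hε
    have hlim : Filter.Tendsto (fun n : ℕ => m {z : ℂ | (n : ℝ) < ‖z‖}) Filter.atTop (nhds 0) := by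
      have h1 := tendsto_measure_iInter_atTop (μ := m) (s := fun n : ℕ => {z : ℂ | (n : ℝ) < ‖z‖})
        (fun n => (measurableSet_lt measurable_const measurable_norm).nullMeasurableSet)
        (fun i j hij z hz => lt_of_le_of_lt (by exact_mod_cast hij : (i : ℝ) ≤ j) hz)
        ⟨0, measure_ne_top _ _⟩
      have h2 : ⋂ n : ℕ, {z : ℂ | (n : ℝ) < ‖z‖} = ∅ := by
        ext z
        obtain ⟨n, hn⟩ := exists_nat_ge ‖z‖
        simp only [Set.mem_iInter, Set.mem_ofPred_eq, Set.mem_empty_iff_false, iff_false, not_forall,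
          not_lt]
        exact ⟨n, hn⟩
      rwa [h2, measure_empty] at h1
    obtain ⟨n, hn1, hn2⟩ := ((hlim.eventually (gt_mem_nhds hε)).and
      (tendsto_natCast_atTop_atTop.eventually_gt_atTop
        (max 0 (‖x₀ - 2 * r * 1‖ + r / 2)))).exists
    have hn0 : (0 : ℝ) < n := (le_max_left _ _).trans_lt hn2
    -- This `t` puts the anchor outside radius `2 n`, where the Cauchy transform of a function
    -- supported in `|z| ≤ n` is known to vanish.
    refine exists_isDetermining_of_anchor (V := {z : ℂ | (n : ℝ) < ‖z‖})
      (t := 2 * n + 1 + ‖x₀‖) hr hu (by positivity) (isOpen_lt continuous_const continuous_norm)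
      (Set.disjoint_left.2 fun z hz hz2 => ?_) ?_ hm hn1
    · have h1 := (le_max_right _ _).trans_lt hn2
      rw [mem_closedBall_iff_norm] at hz2
      have h2 := norm_sub_norm_le z (x₀ - 2 * r * 1)
      have h3 : (n : ℝ) < ‖z‖ := hz
      linarith
    · intro O hO hVO hpO g hg h0 hWz
      have hz := cauchy_eq_zero_of_unbounded hg hn0 (fun z hz => h0 z (hVO hz)) (fun R => by
        obtain ⟨w, hw, hRw⟩ := hunb R
        exact ⟨w, hRw, hWz w hw⟩)
      have hmem : x₀ + ((2 * n + 1 + ‖x₀‖ : ℝ) : ℂ) * 1 ∈ {z : ℂ | 2 * (n : ℝ) < ‖z‖} := by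
        have h1 := norm_sub_le (x₀ + ((2 * n + 1 + ‖x₀‖ : ℝ) : ℂ) * 1) x₀
        rw [add_sub_cancel_left, mul_one, Complex.norm_real,
          Real.norm_of_nonneg (by positivity)] at h1
        rw [mul_one]
        simp only [Set.mem_ofPred_eq]
        linarith
      filter_upwards [(isOpen_lt continuous_const continuous_norm).mem_nhds hmem] with w hw
      exact hz w hw

/-! ### Approximation by elements of `Q(S)` that concentrate on small sets. -/

/-- Integrable functions supported in `Δ` can be approximated by elements of `Q(S)` in mean off a
determining set. -/
theorem exists_Q_approx {S O Δ : Set ℂ} (hS : IsOpen S) {a b c : ℂ} (ha : a ∉ S) (hb : b ∉ S)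
    (hc : c ∉ S) (hab : a ≠ b) (hac : a ≠ c) (hbc : b ≠ c)
    (hO : IsDetermining (Sᶜ \ {a, b, c}) Δ O) {f : ℂ → ℂ} (hf : IntegrableOn f S)
    (hfΔ : ∀ z, z ∉ Δ → f z = 0) {ε : ℝ} (hε : 0 < ε) :
    ∃ φ ∈ Q S, ∫ z in S \ O, ‖φ z - f z‖ < ε := by
  have hKm : MeasurableSet (S \ O) := hS.measurableSet.diff hO.1.measurableSet
  let M : Submodule ℂ (ℂ → ℂ) :=
    { carrier := Q S
      zero_mem' := ⟨differentiableOn_const 0, integrableOn_zero⟩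
      add_mem' := fun hφ hψ => ⟨hφ.1.add hψ.1, hφ.2.add hψ.2⟩
      smul_mem' := fun k φ hφ => ⟨hφ.1.const_smul k, hφ.2.smul k⟩ }
  have hQ : ∀ x y w, x ∉ S → y ∉ S → w ∉ S → x ≠ y → x ≠ w → y ≠ w →
      (fun z => ((z - x) * (z - y) * (z - w))⁻¹) ∈ M := by
    intro x y w hx hy hw hxy hxw hyw
    refine ⟨?_, (integrable_three_poles hxy hxw hyw).integrableOn⟩
    refine DifferentiableOn.inv (by fun_prop) fun z hz => ?_
    have hne : ∀ v, v ∉ S → z - v ≠ 0 := fun v hv => sub_ne_zero.2 fun h => hv (h ▸ hz)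
    exact mul_ne_zero (mul_ne_zero (hne x hx) (hne y hy)) (hne w hw)
  refine exists_mem_integral_norm_sub_lt (μ := volume.restrict (S \ O)) M
    (fun φ hφ => hφ.2.mono_set Set.sdiff_subset) (hf.mono_set Set.sdiff_subset) ?_ hε
  rintro ν hν ⟨C, hC⟩ hann
  -- The annihilator `ν` need not be integrable; the three fixed poles make it so without changing
  -- where it vanishes in `S \ O`.
  let g : ℂ → ℂ := (S \ O).indicator fun z => ν z * ((z - a) * (z - b) * (z - c))⁻¹
  have hgm : Measurable g := (hν.mul (by fun_prop)).indicator hKm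
  have hg : Integrable g :=
    ((integrable_three_poles hab hac hbc).bdd_mul hν.aestronglyMeasurable
      (.of_forall hC)).indicator hKm
  have hgW : ∀ w ∈ Sᶜ \ {a, b, c}, cauchy g w = 0 := by
    rintro w ⟨hwS, hw⟩
    simp only [Set.mem_insert_iff, Set.mem_singleton_iff, not_or] at hw
    obtain ⟨hwa, hwb, hwc⟩ := hw
    have hcw : w - c ≠ 0 := sub_ne_zero.2 hwc
    -- The difference of two three-pole functions sharing `a` and `b`, divided by `w - c`, is `1 /
    -- ((z-a)(z-b)(z-c)(z-w))`. Pairing it with `ν` is the Cauchy transform of `g` at `w`.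
    have h1 := hann _ (M.smul_mem (w - c)⁻¹ (M.sub_mem
      (hQ a b w ha hb hwS hab (Ne.symm hwa) (Ne.symm hwb)) (hQ a b c ha hb hc hab hac hbc)))
    rw [cauchy, ← h1, ← integral_indicator hKm]
    congr 1 with z
    by_cases hz : z ∈ S \ O
    · have hne : ∀ v, v ∉ S → z - v ≠ 0 := fun v hv => sub_ne_zero.2 fun h => hv (h ▸ hz.1)
      have := hne a ha
      have := hne b hb
      have := hne c hc
      have := hne w hwS
      simp only [g, Set.indicator_of_mem hz, Pi.smul_apply, Pi.sub_apply, smul_eq_mul]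
      field_simp
      ring
    · simp [g, hz]
  have hae := hO.2 g hgm hg (fun z hz => Set.indicator_of_notMem (fun h => h.2 hz) _) hgW
  refine integral_eq_zero_of_ae ?_
  rw [Filter.EventuallyEq, ae_restrict_iff' hKm]
  filter_upwards [hae] with z hz hzK
  by_cases hzΔ : z ∈ Δ
  · have h1 := hz hzΔ
    have hne : ∀ v, v ∉ S → z - v ≠ 0 := fun v hv => sub_ne_zero.2 fun h => hv (h ▸ hzK.1)
    simp only [g, Set.indicator_of_mem hzK, mul_eq_zero, inv_eq_zero, hne a ha, hne b hb,
      hne c hc, or_false] at h1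
    simp [h1]
  · simp [hfΔ z hzΔ]

/-- `O` is a set on which an element of `Q(S)` may concentrate: it avoids `B` and is dense in `Δ`. -/
def IsSpread (Δ B O : Set ℂ) : Prop :=
  IsOpen O ∧ Disjoint O B ∧ ∀ E : Set ℂ, IsOpen E → (E ∩ Δ).Nonempty → (E ∩ O).Nonempty

/-- Large mass on a small set is obtained by prescribing it: off a much smaller determining set
`O₁`, the element `φ` approximates `ψ` on the desired part of `Δ` and a large constant on the part
of `O₀` outside `O₁`. The union of `O₀` and `O₁` hides both the constant and the uncontrolled
behaviour. -/
theorem exists_concentrated {S W Δ B : Set ℂ} (hS : IsOpen S) (hΔ : IsOpen Δ) (hΔS : Δ ⊆ S)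
    (hΔne : Δ.Nonempty) (hΔfin : volume Δ ≠ ⊤)
    (H : ∀ (m : Measure ℂ) [IsFiniteMeasure m], m ≪ volume → ∀ ε : ENNReal, 0 < ε →
      ∃ O, IsDetermining W Δ O ∧ m O < ε ∧ Disjoint O B ∧
        ∀ E : Set ℂ, IsOpen E → (E ∩ Δ).Nonempty → (E ∩ O).Nonempty)
    (D : ∀ O, IsDetermining W Δ O → ∀ f : ℂ → ℂ, IntegrableOn f S → (∀ z, z ∉ Δ → f z = 0) →
      ∀ ε : ℝ, 0 < ε → ∃ φ ∈ Q S, ∫ z in S \ O, ‖φ z - f z‖ < ε)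
    (m : Measure ℂ) [IsFiniteMeasure m] (hm : m ≪ volume) {U : Set ℂ} (hU : MeasurableSet U)
    {ψ : ℂ → ℂ} (hψ : IntegrableOn ψ Δ) {ε : ℝ} (hε : 0 < ε) (L : ℝ) :
    ∃ (O : Set ℂ) (φ : ℂ → ℂ), IsSpread Δ B O ∧ φ ∈ Q S ∧ m O < ENNReal.ofReal ε ∧
      ∫ z in S \ O, ‖φ z - (Δ \ U).indicator ψ z‖ < ε ∧ L ≤ ∫ z in S ∩ O, ‖φ z‖ := by
  have hε2 : 0 < ENNReal.ofReal (ε / 2) := ENNReal.ofReal_pos.2 (half_pos hε)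
  obtain ⟨O₀, hO₀, hmO₀, hd₀, hden₀⟩ := H m hm _ hε2
  have hv : 0 < volume (Δ ∩ O₀) := by
    refine (hΔ.inter hO₀.1).measure_pos _ (hden₀ Δ hΔ ?_)
    rwa [Set.inter_self]
  have : IsFiniteMeasure (volume.restrict Δ) := isFiniteMeasure_restrict.2 hΔfin
  obtain ⟨O₁, hO₁, hmO₁, hd₁, hden₁⟩ := H (m + volume.restrict Δ)
    (Measure.AbsolutelyContinuous.add_left hm Measure.restrict_le_self.absolutelyContinuous) _
    (lt_min hε2 hv)
  rw [Measure.add_apply, lt_min_iff] at hmO₁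
  have hm1 : m O₁ < ENNReal.ofReal (ε / 2) := le_self_add.trans_lt hmO₁.1
  have hv1 : volume (Δ ∩ O₁) < volume (Δ ∩ O₀) := by
    refine lt_of_le_of_lt ?_ (le_add_self.trans_lt hmO₁.2)
    rw [Measure.restrict_apply hO₁.1.measurableSet, Set.inter_comm]
  let P := (Δ ∩ O₀) \ O₁
  have hPm : MeasurableSet P :=
    (hΔ.measurableSet.inter hO₀.1.measurableSet).diff hO₁.1.measurableSet
  have hPΔ : P ⊆ Δ := fun z hz => hz.1.1
  have hPfin : volume P ≠ ⊤ := measure_ne_top_of_subset hPΔ hΔfin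
  have hPpos : 0 < volume.real P := by
    refine ENNReal.toReal_pos (fun h0 => ?_) hPfin
    refine hv1.not_ge ?_
    calc volume (Δ ∩ O₀) ≤ volume (P ∪ (Δ ∩ O₁)) := by
          refine measure_mono fun z hz => ?_
          by_cases hz1 : z ∈ O₁
          · exact .inr ⟨hz.1, hz1⟩
          · exact .inl ⟨hz, hz1⟩
      _ ≤ volume P + volume (Δ ∩ O₁) := measure_union_le _ _
      _ = volume (Δ ∩ O₁) := by rw [h0, zero_add]
  -- The constant has mass `L + ε` on `P`, and the approximation loses at most `ε` of it.
  let K : ℝ := (L + ε) / volume.real P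
  let G := (Δ \ U) \ (O₀ ∪ O₁)
  have hGm : MeasurableSet G := (hΔ.measurableSet.diff hU).diff (hO₀.1.union hO₁.1).measurableSet
  let f : ℂ → ℂ := fun z => G.indicator ψ z + P.indicator (fun _ => (K : ℂ)) z
  have hfint : Integrable f := by
    refine Integrable.add ((integrable_indicator_iff hGm).2 (hψ.mono_set fun z hz => hz.1.1))
      ((integrable_indicator_iff hPm).2 ?_)
    exact integrableOn_const hPfin
  have hfΔ : ∀ z, z ∉ Δ → f z = 0 := by
    intro z hz
    have h1 : z ∉ G := fun h => hz h.1.1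
    have h2 : z ∉ P := fun h => hz h.1.1
    simp [f, h1, h2]
  obtain ⟨φ, hφ, hφε⟩ := D O₁ hO₁ f hfint.integrableOn hfΔ ε hε
  have hdiff : IntegrableOn (fun z => ‖φ z - f z‖) (S \ O₁) :=
    ((hφ.2.sub hfint.integrableOn).mono_set Set.sdiff_subset).norm
  have hSm := hS.measurableSet
  refine ⟨O₀ ∪ O₁, φ, ⟨hO₀.1.union hO₁.1, hd₀.union_left hd₁, fun E hE hne =>
    (hden₀ E hE hne).mono (Set.inter_subset_inter_right _ Set.subset_union_left)⟩, hφ, ?_, ?_, ?_⟩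
  · calc m (O₀ ∪ O₁) ≤ m O₀ + m O₁ := measure_union_le _ _
      _ < ENNReal.ofReal (ε / 2) + ENNReal.ofReal (ε / 2) := ENNReal.add_lt_add hmO₀ hm1
      _ = ENNReal.ofReal ε := by rw [← ENNReal.ofReal_add (half_pos hε).le (half_pos hε).le,
          add_halves]
  · refine lt_of_le_of_lt ?_ hφε
    rw [setIntegral_congr_fun (g := fun z => ‖φ z - f z‖)
      (hSm.diff (hO₀.1.union hO₁.1).measurableSet)]
    · exact setIntegral_mono_set hdiff (.of_forall fun z => norm_nonneg _)
        (Set.sdiff_subset_sdiff_right Set.subset_union_right).eventuallyLE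
    · intro z hz
      have h2 : z ∉ P := fun h => hz.2 (.inl h.1.2)
      by_cases hzU : z ∈ Δ \ U
      · have h1 : z ∈ G := ⟨hzU, hz.2⟩
        simp only [f, Set.indicator_of_mem h1, Set.indicator_of_notMem h2,
          Set.indicator_of_mem hzU, add_zero]
      · have h1 : z ∉ G := fun h => hzU h.1
        simp only [f, Set.indicator_of_notMem h1, Set.indicator_of_notMem h2,
          Set.indicator_of_notMem hzU, add_zero]
  · have hPS : P ⊆ S ∩ (O₀ ∪ O₁) := fun z hz => ⟨hΔS hz.1.1, .inl hz.1.2⟩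
    have hPS1 : P ⊆ S \ O₁ := fun z hz => ⟨hΔS hz.1.1, hz.2⟩
    have hφP : IntegrableOn (fun z => ‖φ z‖) P :=
      (hφ.2.mono_set (hPS.trans Set.inter_subset_left)).norm
    have h1 : ∫ z in P, ‖φ z‖ ≤ ∫ z in S ∩ (O₀ ∪ O₁), ‖φ z‖ :=
      setIntegral_mono_set (hφ.2.mono_set Set.inter_subset_left).norm
        (.of_forall fun z => norm_nonneg _) hPS.eventuallyLE
    have h2 : ∫ z in P, ‖φ z - f z‖ ≤ ∫ z in S \ O₁, ‖φ z - f z‖ :=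
      setIntegral_mono_set hdiff (.of_forall fun z => norm_nonneg _) hPS1.eventuallyLE
    have h3 : ∫ z in P, K ≤ ∫ z in P, (‖φ z‖ + ‖φ z - f z‖) := by
      refine setIntegral_mono_on (integrableOn_const hPfin) (hφP.add (hdiff.mono_set hPS1)) hPm
        fun z hz => ?_
      have hzG : z ∉ G := fun h => h.2 (.inl hz.1.2)
      have hfz : f z = K := by
        simp only [f, Set.indicator_of_notMem hzG, Set.indicator_of_mem hz, zero_add]
      have := norm_sub_le (φ z) (φ z - f z)
      rw [sub_sub_cancel, hfz, Complex.norm_real] at this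
      rw [hfz]
      exact (le_abs_self K).trans this
    rw [integral_add hφP (hdiff.mono_set hPS1), setIntegral_const, smul_eq_mul,
      mul_div_cancel₀ _ hPpos.ne'] at h3
    linarith

/-- The recursion carries a measure and a set. The measure `volume|_Δ + ∑ |φ k|` makes the next `O`
small for the area and for all earlier `φ k`; the set `U` is the union of the earlier `O k`, where
the next `φ` should be small. -/
theorem exists_concentrated_seq {S Δ B : Set ℂ} (hΔfin : volume Δ ≠ ⊤)
    {ψ : ℕ → ℂ → ℂ} {ε L : ℕ → ℝ}
    (step : ∀ (n : ℕ) (m : Measure ℂ) [IsFiniteMeasure m], m ≪ volume → ∀ U : Set ℂ,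
      MeasurableSet U → ∃ (O : Set ℂ) (φ : ℂ → ℂ), IsSpread Δ B O ∧ φ ∈ Q S ∧
        m O < ENNReal.ofReal (ε n) ∧
        ∫ z in S \ O, ‖φ z - (Δ \ U).indicator (ψ n) z‖ < ε n ∧
        L n ≤ ∫ z in S ∩ O, ‖φ z‖) :
    ∃ (O : ℕ → Set ℂ) (φ : ℕ → ℂ → ℂ), ∀ n, IsSpread Δ B (O n) ∧ φ n ∈ Q S ∧
      volume (Δ ∩ O n) < ENNReal.ofReal (ε n) ∧
      (∀ k < n, ∫ z in S ∩ O n, ‖φ k z‖ < ε n) ∧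
      ∫ z in S \ O n, ‖φ n z - (Δ \ ⋃ k < n, O k).indicator (ψ n) z‖ < ε n ∧
      L n ≤ ∫ z in S ∩ O n, ‖φ n z‖ := by
  let St := {x : Measure ℂ × Set ℂ // IsFiniteMeasure x.1 ∧ x.1 ≪ volume ∧ MeasurableSet x.2}
  have step' : ∀ (n : ℕ) (x : St), ∃ (O : Set ℂ) (φ : ℂ → ℂ), IsSpread Δ B O ∧ φ ∈ Q S ∧
        x.1.1 O < ENNReal.ofReal (ε n) ∧
        ∫ z in S \ O, ‖φ z - (Δ \ x.1.2).indicator (ψ n) z‖ < ε n ∧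
        L n ≤ ∫ z in S ∩ O, ‖φ z‖ := by
    rintro n ⟨⟨m, U⟩, h1, h2, h3⟩
    have : IsFiniteMeasure m := h1
    exact step n m h2 U h3
  choose O φ hspread hQ hmO happ hL using step'
  let d : (ℂ → ℂ) → Measure ℂ := fun φ => (volume.restrict S).withDensity fun z => ‖φ z‖ₑ
  let init : St := ⟨(volume.restrict Δ, ∅), isFiniteMeasure_restrict.2 hΔfin,
    Measure.restrict_le_self.absolutelyContinuous, .empty⟩
  let next : ℕ → St → St := fun n x => ⟨(x.1.1 + d (φ n x), x.1.2 ∪ O n x), by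
    have := x.2.1
    have : IsFiniteMeasure (d (φ n x)) := isFiniteMeasure_withDensity (hQ n x).2.2.ne
    infer_instance,
    Measure.AbsolutelyContinuous.add_left x.2.2.1 ((withDensity_absolutelyContinuous _ _).trans
      Measure.restrict_le_self.absolutelyContinuous),
    x.2.2.2.union (hspread n x).1.measurableSet⟩
  let st : ℕ → St := fun n => Nat.rec init next n
  have hst : ∀ n, st (n + 1) = next n (st n) := fun n => rfl
  have hmono : Monotone fun n => (st n).1.1 := by
    refine monotone_nat_of_le_succ fun n => ?_
    rw [hst]
    exact Measure.le_add_right le_rfl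
  have hUn : ∀ n, (st n).1.2 = ⋃ k < n, O k (st k) := by
    intro n
    induction n with
    | zero => simp [st, init]
    | succ n ih => rw [hst, Set.biUnion_lt_succ, ← ih]
  refine ⟨fun n => O n (st n), fun n => φ n (st n), fun n => ⟨hspread _ _, hQ _ _, ?_, ?_, ?_,
    hL _ _⟩⟩
  · refine lt_of_le_of_lt ?_ (hmO n (st n))
    refine le_trans ?_ (hmono (Nat.zero_le n) _)
    change _ ≤ volume.restrict Δ _
    rw [Measure.restrict_apply (hspread _ _).1.measurableSet, Set.inter_comm]
  · intro k hk
    have hOm := (hspread n (st n)).1.measurableSet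
    have h1 : d (φ k (st k)) (O n (st n)) < ENNReal.ofReal (ε n) := by
      refine lt_of_le_of_lt ?_ (hmO n (st n))
      refine le_trans ?_ (hmono (Nat.succ_le_of_lt hk) _)
      change _ ≤ (st (k + 1)).1.1 _
      rw [hst]
      exact le_add_self
    have h2 := (hQ k (st k)).2.mono_set (Set.inter_subset_left (s := S) (t := O n (st n)))
    rw [integral_norm_eq_lintegral_enorm h2.1]
    refine (ENNReal.lt_ofReal_iff_toReal_lt h2.2.ne).1 ?_
    rwa [withDensity_apply _ hOm, Measure.restrict_restrict hOm, Set.inter_comm] at h1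
  · rw [← hUn]
    exact happ _ _

/-! ### A unimodular annihilator on a disc, and a recurrent dense sequence. -/

theorem measurable_indicator_of_mem_Q {S : Set ℂ} (hS : IsOpen S) {φ : ℂ → ℂ} (hφ : φ ∈ Q S) :
    Measurable (S.indicator φ) := by
  classical
  rw [← Set.piecewise_eq_indicator]
  exact hφ.1.continuousOn.measurable_piecewise continuousOn_const hS.measurableSet

/-- The unimodular function `(z - y) / |z - y|` on a disc about `y` annihilates holomorphic
functions. -/
theorem setIntegral_ball_direction_mul_eq_zero {S : Set ℂ} (hS : IsOpen S) {φ : ℂ → ℂ}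
    (hφ : φ ∈ Q S) {y : ℂ} {s : ℝ} (hB : Metric.closedBall y s ⊆ S) :
    ∫ z in Metric.ball y s, (z - y) / ‖z - y‖ * φ z = 0 := by
  let Φ : ℂ → ℂ := (Metric.ball (0 : ℂ) s).indicator fun w => w / ‖w‖ * S.indicator φ (y + w)
  have hΦm : Measurable Φ :=
    ((measurable_id.div (Complex.measurable_ofReal.comp measurable_norm)).mul
      ((measurable_indicator_of_mem_Q hS hφ).comp (measurable_const_add y))).indicator
      measurableSet_ball
  have hΦint : Integrable Φ := by
    have h1 : Integrable (fun w => S.indicator φ (y + w)) :=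
      ((integrable_indicator_iff hS.measurableSet).2 hφ.2).comp_add_left y
    refine (h1.norm.mono' hΦm.aestronglyMeasurable (.of_forall fun w => ?_))
    by_cases hw : w ∈ Metric.ball (0 : ℂ) s
    · simp only [Φ, Set.indicator_of_mem hw]
      rw [norm_mul, norm_div, Complex.norm_real, norm_norm]
      exact mul_le_of_le_one_left (norm_nonneg _) (div_self_le_one _)
    · simp only [Φ, Set.indicator_of_notMem hw, norm_zero]
      exact norm_nonneg _
  have h1 : ∫ z in Metric.ball y s, (z - y) / ‖z - y‖ * φ z = ∫ w, Φ w := by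
    rw [← integral_indicator measurableSet_ball, ← integral_add_left_eq_self _ y]
    congr 1 with w
    have hiff : y + w ∈ Metric.ball y s ↔ w ∈ Metric.ball (0 : ℂ) s := by
      rw [mem_ball_iff_norm, add_sub_cancel_left, mem_ball_zero_iff]
    by_cases hw : w ∈ Metric.ball (0 : ℂ) s
    · have hyw := hiff.2 hw
      rw [Set.indicator_of_mem hyw]
      simp only [Φ, Set.indicator_of_mem hw, add_sub_cancel_left,
        Set.indicator_of_mem (hB (Metric.ball_subset_closedBall hyw))]
    · rw [Set.indicator_of_notMem (fun h => hw (hiff.1 h))]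
      simp only [Φ, Set.indicator_of_notMem hw]
  have hpm : Measurable fun p : ℝ × ℝ => p.1 • Φ (Complex.polarCoord.symm p) := by
    have h2 : Measurable fun p : ℝ × ℝ => Complex.polarCoord.symm p := by
      simp only [Complex.polarCoord_symm_apply]
      fun_prop
    exact measurable_fst.smul (hΦm.comp h2)
  have hpint : IntegrableOn (fun p : ℝ × ℝ => p.1 • Φ (Complex.polarCoord.symm p))
      (Set.Ioi (0 : ℝ) ×ˢ Set.Ioo (-Real.pi) Real.pi) := by
    refine ⟨hpm.aestronglyMeasurable, ?_⟩
    have h2 := Complex.lintegral_comp_polarCoord_symm fun w => ‖Φ w‖ₑ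
    rw [hasFiniteIntegral_iff_enorm]
    refine lt_of_eq_of_lt ?_ hΦint.2
    rw [← h2]
    refine setLIntegral_congr_fun polarCoord.open_target.measurableSet fun p hp => ?_
    have hp0 : 0 < p.1 := hp.1
    change ‖p.1 • Φ (Complex.polarCoord.symm p)‖ₑ = _
    rw [enorm_smul, Real.enorm_of_nonneg hp0.le, smul_eq_mul]
  rw [h1, ← Complex.integral_comp_polarCoord_symm]
  change ∫ p in Set.Ioi (0 : ℝ) ×ˢ Set.Ioo (-Real.pi) Real.pi, _ = 0
  rw [Measure.volume_eq_prod, setIntegral_prod _ hpint]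
  refine setIntegral_eq_zero_of_forall_eq_zero fun r hr => ?_
  have hr0 : 0 < r := hr
  by_cases hrs : r < s
  · have hcirc : (∮ w in C(y, r), φ w) = 0 := by
      refine Complex.circleIntegral_eq_zero_of_differentiable_on_off_countable hr0.le
        Set.countable_empty ?_ ?_
      · exact hφ.1.continuousOn.mono ((Metric.closedBall_subset_closedBall hrs.le).trans hB)
      · rintro z ⟨hz, -⟩
        exact hφ.1.differentiableAt (hS.mem_nhds (hB (Metric.ball_subset_closedBall
          (Metric.ball_subset_ball hrs.le hz))))
    have hper : Function.Periodic
        (fun θ => deriv (circleMap y r) θ • φ (circleMap y r θ)) (2 * Real.pi) := by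
      intro θ
      simp only [deriv_circleMap]
      rw [periodic_circleMap, periodic_circleMap]
    rw [circleIntegral] at hcirc
    have h3 := hper.intervalIntegral_add_eq (-Real.pi) 0
    rw [zero_add, hcirc, intervalIntegral.integral_of_le (by linarith [Real.pi_pos]),
      show -Real.pi + 2 * Real.pi = Real.pi by ring, integral_Ioc_eq_integral_Ioo] at h3
    -- On a circle about `y`, the phase `(z - y) / |z - y|` times `r dθ` is `-i dz`, so Cauchy's
    -- theorem kills each circle.
    have h4 : ∀ θ : ℝ, r • Φ (Complex.polarCoord.symm (r, θ)) =
        -Complex.I * (deriv (circleMap y r) θ • φ (circleMap y r θ)) := by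
      intro θ
      have h5 : Complex.polarCoord.symm (r, θ) = circleMap 0 r θ := by
        simp [circleMap, Complex.exp_mul_I]
      have h6 : y + circleMap 0 r θ = circleMap y r θ := by simp [circleMap]
      have hmem : circleMap 0 r θ ∈ Metric.ball (0 : ℂ) s := by simpa [abs_of_pos hr0] using hrs
      have hmemS : circleMap y r θ ∈ S := hB (by
        rw [← h6, mem_closedBall_iff_norm, add_sub_cancel_left, norm_circleMap_zero,
          abs_of_pos hr0]
        exact hrs.le)
      have hrc : (r : ℂ) ≠ 0 := by exact_mod_cast hr0.ne'
      simp only [h5, Φ, Set.indicator_of_mem hmem, h6, Set.indicator_of_mem hmemS,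
        norm_circleMap_zero, abs_of_pos hr0, deriv_circleMap, smul_eq_mul, Complex.real_smul]
      field_simp
      rw [Complex.I_sq]; ring
    simp only [h4]
    rw [integral_const_mul, h3, mul_zero]
  · refine setIntegral_eq_zero_of_forall_eq_zero fun θ _ => ?_
    have : Complex.polarCoord.symm (r, θ) ∉ Metric.ball (0 : ℂ) s := by
      rw [mem_ball_zero_iff, Complex.norm_polarCoord_symm, abs_of_pos hr0]; exact hrs
    simp only [Φ, Set.indicator_of_notMem this, smul_zero]

/-- A sequence of integrable functions that comes arbitrarily close to every integrable function
infinitely often. -/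
theorem exists_recurrent_seq (Δ : Set ℂ) :
    ∃ ψ : ℕ → ℂ → ℂ, (∀ n, IntegrableOn (ψ n) Δ) ∧ ∀ f : ℂ → ℂ, IntegrableOn f Δ →
      ∀ δ > 0, ∀ N : ℕ, ∃ n ≥ N, ∫ z in Δ, ‖ψ n z - f z‖ < δ := by
  have : Fact ((1 : ENNReal) ≠ ⊤) := ⟨ENNReal.one_ne_top⟩
  obtain ⟨χ, hχ⟩ := TopologicalSpace.exists_dense_seq (Lp ℂ 1 (volume.restrict Δ))
  -- Indexing by the first component of a pair repeats each term of the dense sequence infinitely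
  -- often.
  refine ⟨fun n => χ (Nat.unpair n).1, fun n => L1.integrable_coeFn _, fun f hf δ hδ N => ?_⟩
  obtain ⟨j, hj⟩ := hχ.exists_dist_lt (hf.toL1 f) hδ
  refine ⟨Nat.pair j N, Nat.right_le_pair j N, ?_⟩
  rw [dist_comm, dist_eq_norm, L1.norm_eq_integral_norm] at hj
  simp only [Nat.unpair_pair]
  refine lt_of_eq_of_lt (integral_congr_ae ?_) hj
  filter_upwards [Lp.coeFn_sub (χ j) (hf.toL1 f), hf.coeFn_toL1] with z hz hz2
  rw [hz, Pi.sub_apply, hz2]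

/-! ### Concentrated systems. -/

/-- A set `C` of positive measure together with elements `φ n` of `Q(S)` that approximate `ψ n` on
`C` and otherwise concentrate on the pairwise disjoint sets `B n`. -/
structure ConcentratedSystem (S Δ D : Set ℂ) (ψ : ℕ → ℂ → ℂ) (L : ℕ → ℝ) where
  C : Set ℂ
  B : ℕ → Set ℂ
  φ : ℕ → ℂ → ℂ
  e : ℕ → ℝ
  measurableSet_C : MeasurableSet C
  C_subset : C ⊆ Δ
  C_pos : 0 < volume C
  measurableSet_B : ∀ n, MeasurableSet (B n)
  disjoint_B : Pairwise fun i j => Disjoint (B i) (B j)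
  disjoint_BC : ∀ n, Disjoint (B n) C
  disjoint_BD : ∀ n, Disjoint (B n) D
  measure_diff_pos : ∀ E : Set ℂ, IsOpen E → (E ∩ Δ).Nonempty → 0 < volume (E \ C)
  mem_Q : ∀ n, φ n ∈ Q S
  e_le_one : ∀ n, e n ≤ 1
  tendsto_e : Filter.Tendsto e Filter.atTop (nhds 0)
  integral_norm_le : ∀ n, ∫ z in (S \ C) \ B n, ‖φ n z‖ ≤ e n
  integral_norm_sub_le : ∀ n, ∫ z in C, ‖φ n z - ψ n z‖ ≤ e n
  le_integral : ∀ n, L n ≤ ∫ z in S, ‖φ n z‖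

/-- `C` is `Δ` minus all the `O n`, and `B n` is `O n` minus all later ones. Positive measure of `C`
follows from summability of the areas; `O 0` alone, being open and meeting every open set that meets
`Δ`, keeps the complement of `C` large. -/
theorem exists_concentratedSystem {S Δ D : Set ℂ} (hS : IsOpen S) (hΔ : IsOpen Δ) (hΔS : Δ ⊆ S)
    (hΔne : Δ.Nonempty) (hΔfin : volume Δ ≠ ⊤) {ψ : ℕ → ℂ → ℂ} (hψ : ∀ n, IntegrableOn (ψ n) Δ)
    {L : ℕ → ℝ}
    (step : ∀ (n : ℕ) (ε : ℝ), 0 < ε → ∀ (m : Measure ℂ) [IsFiniteMeasure m], m ≪ volume →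
      ∀ U : Set ℂ, MeasurableSet U → ∃ (O : Set ℂ) (φ : ℂ → ℂ), IsSpread Δ D O ∧ φ ∈ Q S ∧
        m O < ENNReal.ofReal ε ∧
        ∫ z in S \ O, ‖φ z - (Δ \ U).indicator (ψ n) z‖ < ε ∧
        L n ≤ ∫ z in S ∩ O, ‖φ z‖) :
    Nonempty (ConcentratedSystem S Δ D ψ L) := by
  have hvΔ : 0 < volume.real Δ := ENNReal.toReal_pos (hΔ.measure_pos _ hΔne).ne' hΔfin
  -- The total `∑ ε n = 2 η` is then below the area of `Δ`, and the errors `2 ε n` are at most 1.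
  let η : ℝ := min (volume.real Δ / 4) (1 / 2)
  have hη : 0 < η := lt_min (by positivity) (by norm_num)
  let ε : ℕ → ℝ := fun n => η * (1 / 2) ^ n
  have hε : ∀ n, 0 < ε n := fun n => by positivity
  have hsum : HasSum ε (2 * η) := by
    have := hasSum_geometric_two.mul_left η
    rwa [mul_comm η 2] at this
  have htail : ∀ n, HasSum (fun k => ε (n + 1 + k)) (ε n) := by
    intro n
    have h1 := hasSum_geometric_two.mul_left (η * (1 / 2) ^ (n + 1))
    have h2 : (fun k => ε (n + 1 + k)) = fun k => η * (1 / 2) ^ (n + 1) * (1 / 2) ^ k := by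
      ext k; change η * (1 / 2) ^ (n + 1 + k) = _; rw [pow_add]; ring
    have h3 : ε n = η * (1 / 2) ^ (n + 1) * 2 := by
      change η * (1 / 2) ^ n = _; rw [pow_succ]; ring
    rw [h2, h3]
    exact h1
  obtain ⟨O, φ, hOφ⟩ := exists_concentrated_seq hΔfin (ε := ε) (L := L)
    (fun n m _ hm U hU => step n (ε n) (hε n) m hm U hU)
  have hOo : ∀ n, IsOpen (O n) := fun n => (hOφ n).1.1
  have hOm : ∀ n, MeasurableSet (O n) := fun n => (hOo n).measurableSet
  have hφ : ∀ n, φ n ∈ Q S := fun n => (hOφ n).2.1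
  let C := Δ \ ⋃ n, O n
  have hCm : MeasurableSet C := hΔ.measurableSet.diff (.iUnion hOm)
  let T : ℕ → Set ℂ := fun n => ⋃ k, O (n + 1 + k)
  have hTm : ∀ n, MeasurableSet (T n) := fun n => .iUnion fun k => hOm _
  let B : ℕ → Set ℂ := fun n => O n \ T n
  have hBm : ∀ n, MeasurableSet (B n) := fun n => (hOm n).diff (hTm n)
  have hBO : ∀ n, B n ⊆ O n := fun n => Set.sdiff_subset
  have hOT : ∀ m n, m < n → O n ⊆ T m := by
    intro m n hmn z hz
    refine Set.mem_iUnion.2 ⟨n - (m + 1), ?_⟩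
    rwa [Nat.add_sub_cancel' hmn]
  have hT : ∀ n, ∫ z in S ∩ T n, ‖φ n z‖ ≤ ε n := by
    intro n
    have h1 := (hφ n).2.mono_set (Set.inter_subset_left (s := S) (t := T n))
    rw [integral_norm_eq_lintegral_enorm h1.1]
    refine ENNReal.toReal_le_of_le_ofReal (hε n).le ?_
    rw [Set.inter_iUnion]
    refine (lintegral_iUnion_le _ _).trans ?_
    rw [← (htail n).tsum_eq, ENNReal.ofReal_tsum_of_nonneg (fun k => (hε _).le) (htail n).summable]
    refine ENNReal.tsum_le_tsum fun k => ?_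
    have h2 := (hφ n).2.mono_set (Set.inter_subset_left (s := S) (t := O (n + 1 + k)))
    have h3 := (hOφ (n + 1 + k)).2.2.2.1 n (by omega)
    rw [integral_norm_eq_lintegral_enorm h2.1] at h3
    exact ((ENNReal.lt_ofReal_iff_toReal_lt h2.2.ne).2 h3).le
  have happ : ∀ n, ∫ z in S \ O n, ‖φ n z - (Δ \ ⋃ k < n, O k).indicator (ψ n) z‖ < ε n :=
    fun n => (hOφ n).2.2.2.2.1
  have happi : ∀ n, IntegrableOn (fun z => ‖φ n z - (Δ \ ⋃ k < n, O k).indicator (ψ n) z‖)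
      (S \ O n) := by
    intro n
    have h1 : MeasurableSet (Δ \ ⋃ k < n, O k) :=
      hΔ.measurableSet.diff (.biUnion (Set.to_countable {k | k < n}) fun k _ => hOm k)
    exact (((hφ n).2.sub ((integrable_indicator_iff h1).2
      ((hψ n).mono_set Set.sdiff_subset)).integrableOn).mono_set Set.sdiff_subset).norm
  have hCO : ∀ n, C ⊆ S \ O n := fun n z hz =>
    ⟨hΔS hz.1, fun h => hz.2 (Set.mem_iUnion.2 ⟨n, h⟩)⟩
  refine ⟨{ C := C, B := B, φ := φ, e := fun n => 2 * ε n, measurableSet_C := hCm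
            C_subset := Set.sdiff_subset, C_pos := ?_, measurableSet_B := hBm, disjoint_B := ?_
            disjoint_BC := ?_, disjoint_BD := fun n => (hOφ n).1.2.1.mono_left (hBO n)
            measure_diff_pos := ?_, mem_Q := hφ, e_le_one := ?_, tendsto_e := ?_
            integral_norm_le := ?_, integral_norm_sub_le := ?_, le_integral := ?_ }⟩
  · have h1 : volume (Δ ∩ ⋃ n, O n) < volume Δ := by
      rw [Set.inter_iUnion]
      calc volume (⋃ n, Δ ∩ O n) ≤ ∑' n, volume (Δ ∩ O n) := measure_iUnion_le _
        _ ≤ ∑' n, ENNReal.ofReal (ε n) := ENNReal.tsum_le_tsum fun n => (hOφ n).2.2.1.le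
        _ = ENNReal.ofReal (2 * η) := by
          rw [← ENNReal.ofReal_tsum_of_nonneg (fun n => (hε n).le) hsum.summable, hsum.tsum_eq]
        _ < volume Δ := by
          rw [ENNReal.ofReal_lt_iff_lt_toReal (by positivity) hΔfin]
          have : η ≤ volume.real Δ / 4 := min_le_left _ _
          change 2 * η < volume.real Δ
          linarith
    rw [pos_iff_ne_zero]
    intro h0
    have h2 := measure_inter_add_sdiff (μ := volume) Δ (MeasurableSet.iUnion hOm)
    change _ + volume C = _ at h2
    rw [h0, add_zero] at h2
    exact h1.ne h2
  · have key : ∀ i j, i < j → Disjoint (B i) (B j) := fun i j hij =>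
      Set.disjoint_left.2 fun z hz hz2 => hz.2 (hOT i j hij (hBO j hz2))
    intro i j hij
    rcases lt_or_gt_of_ne hij with h | h
    · exact key i j h
    · exact (key j i h).symm
  · exact fun n => Set.disjoint_left.2 fun z hz hz2 => (hCO n hz2).2 (hBO n hz)
  · intro E hE hne
    have h1 := (hOφ 0).1.2.2 E hE hne
    exact ((hE.inter (hOo 0)).measure_pos _ h1).trans_le
      (measure_mono fun z hz => ⟨hz.1, fun h => (hCO 0 h).2 hz.2⟩)
  · intro n
    have h1 : η ≤ 1 / 2 := min_le_right _ _
    have h2 : ((1 : ℝ) / 2) ^ n ≤ 1 := pow_le_one₀ (by norm_num) (by norm_num)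
    have h3 : ε n ≤ 1 / 2 * 1 := mul_le_mul h1 h2 (by positivity) (by norm_num)
    linarith
  · have := hsum.summable.tendsto_atTop_zero.const_mul 2
    rwa [mul_zero] at this
  · intro n
    -- Off `C` and `B n`, a point lies either in a later `O k`, where `φ n` is small by the choice
    -- of that `O k`, or in `A`. On `A` the function approximated by `φ n` is 0: points of `A` in
    -- `Δ` belong to an earlier `O k`.
    let A := ((S \ C) \ O n) \ T n
    have hAm : MeasurableSet A := ((hS.measurableSet.diff hCm).diff (hOm n)).diff (hTm n)
    have hAS : A ⊆ S \ O n := fun z hz => ⟨hz.1.1.1, hz.1.2⟩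
    have hTS : MeasurableSet (S ∩ T n) := hS.measurableSet.inter (hTm n)
    have hA : ∫ z in A, ‖φ n z‖ ≤ ε n := by
      have h1 : ∫ z in A, ‖φ n z‖ =
          ∫ z in A, ‖φ n z - (Δ \ ⋃ k < n, O k).indicator (ψ n) z‖ := by
        refine setIntegral_congr_fun hAm fun z hz => ?_
        have hz' : z ∉ Δ \ ⋃ k < n, O k := by
          rintro ⟨hzΔ, hzO⟩
          refine hz.1.1.2 ⟨hzΔ, fun h => ?_⟩
          obtain ⟨k, hk⟩ := Set.mem_iUnion.1 h
          rcases lt_trichotomy k n with hkn | rfl | hkn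
          · exact hzO (Set.mem_biUnion (show k ∈ {k | k < n} from hkn) hk)
          · exact hz.1.2 hk
          · exact hz.2 (hOT n k hkn hk)
        simp only [Set.indicator_of_notMem hz', sub_zero]
      rw [h1]
      exact (setIntegral_mono_set (happi n) (.of_forall fun z => norm_nonneg _)
        hAS.eventuallyLE).trans (happ n).le
    have hAT : Disjoint A (S ∩ T n) := Set.disjoint_left.2 fun z hz hz2 => hz.2 hz2.2
    have hint : ∀ {X : Set ℂ}, X ⊆ S → IntegrableOn (fun z => ‖φ n z‖) X :=
      fun hX => ((hφ n).2.mono_set hX).norm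
    have hA' : A ⊆ S := fun z hz => hz.1.1.1
    calc ∫ z in (S \ C) \ B n, ‖φ n z‖ ≤ ∫ z in A ∪ (S ∩ T n), ‖φ n z‖ := by
          refine setIntegral_mono_set (hint (Set.union_subset hA' Set.inter_subset_left))
            (.of_forall fun z => norm_nonneg _) (LE.le.eventuallyLE fun z hz => ?_)
          by_cases hzT : z ∈ T n
          · exact .inr ⟨hz.1.1, hzT⟩
          · exact .inl ⟨⟨hz.1, fun h => hz.2 ⟨h, hzT⟩⟩, hzT⟩
      _ = _ := setIntegral_union hAT hTS (hint hA') (hint Set.inter_subset_left)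
      _ ≤ 2 * ε n := by linarith [hT n]
  · intro n
    have h1 : ∫ z in C, ‖φ n z - ψ n z‖ =
        ∫ z in C, ‖φ n z - (Δ \ ⋃ k < n, O k).indicator (ψ n) z‖ := by
      refine setIntegral_congr_fun hCm fun z hz => ?_
      have hz' : z ∈ Δ \ ⋃ k < n, O k := ⟨hz.1, fun h => hz.2 (by
        obtain ⟨k, -, hk⟩ := Set.mem_iUnion₂.1 h
        exact Set.mem_iUnion.2 ⟨k, hk⟩)⟩
      simp only [Set.indicator_of_mem hz']
    rw [h1]
    have := (setIntegral_mono_set (happi n) (.of_forall fun z => norm_nonneg _)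
      (hCO n).eventuallyLE).trans (happ n).le
    linarith [hε n]
  · intro n
    exact (hOφ n).2.2.2.2.2.trans (setIntegral_mono_set (hφ n).2.norm
      (.of_forall fun z => norm_nonneg _) Set.inter_subset_left.eventuallyLE)

/-! ### Differentials aligned with a concentrated system. -/

theorem pairing_eq_of_cls_eq {S : Set ℂ} {μ ν : Bel S} (h : cls μ = cls ν) {φ : ℂ → ℂ}
    (hφ : φ ∈ Q S) : pairing μ φ = pairing ν φ := by
  have h1 : μ - ν ∈ N S := (Submodule.Quotient.eq _).1 h
  have h2 := pairing_add (μ - ν) ν hφ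
  rwa [sub_add_cancel, h1 φ hφ, zero_add] at h2

theorem ae_norm_le {S : Set ℂ} (μ : Bel S) : ∀ᵐ z ∂volume.restrict S, ‖μ z‖ ≤ ‖μ‖ := by
  filter_upwards [ae_le_eLpNormEssSup (f := μ) (μ := volume.restrict S)] with z hz
  rw [Lp.norm_def, eLpNorm_exponent_top]
  have h1 : eLpNormEssSup μ (volume.restrict S) ≠ ⊤ := by
    rw [← eLpNorm_exponent_top]; exact Lp.eLpNorm_ne_top μ
  simpa using ENNReal.toReal_mono h1 hz

theorem re_pairing {S : Set ℂ} (μ : Bel S) {φ : ℂ → ℂ} (hφ : φ ∈ Q S) :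
    (pairing μ φ).re = ∫ z in S, (μ z * φ z).re :=
  (Complex.reCLM.integral_comp_comm (integrable_mul μ hφ)).symm

namespace ConcentratedSystem

variable {S Δ D : Set ℂ} {ψ : ℕ → ℂ → ℂ} {L : ℕ → ℝ}

/-- The conjugate phases of the different `φ n` are compatible because the `B n` are disjoint; 1
serves as the phase elsewhere and at zeros. -/
theorem exists_unimodular (X : ConcentratedSystem S Δ D ψ L) (hS : IsOpen S) :
    ∃ b : ℂ → ℂ, Measurable b ∧ (∀ z, ‖b z‖ = 1) ∧
      ∀ n, ∀ z ∈ S ∩ X.B n, b z * X.φ n z = ‖X.φ n z‖ := by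
  classical
  let sgn : ℂ → ℂ := fun w => if w = 0 then 1 else starRingEnd ℂ w / ‖w‖
  have hsgnm : Measurable sgn := by
    refine Measurable.ite (measurableSet_singleton 0) measurable_const ?_
    exact Complex.continuous_conj.measurable.div (Complex.measurable_ofReal.comp measurable_norm)
  have hsgn1 : ∀ w, ‖sgn w‖ = 1 := by
    intro w
    by_cases hw : w = 0
    · simp [sgn, hw]
    · simp only [sgn, if_neg hw, norm_div, RCLike.norm_conj, Complex.norm_real, norm_norm]
      exact div_self (norm_ne_zero_iff.2 hw)
  have hsgn2 : ∀ w, sgn w * w = ‖w‖ := by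
    intro w
    by_cases hw : w = 0
    · simp [hw]
    · have : (‖w‖ : ℂ) ≠ 0 := by exact_mod_cast norm_ne_zero_iff.2 hw
      simp only [sgn, if_neg hw]
      rw [div_mul_eq_mul_div, div_eq_iff this, mul_comm, Complex.mul_conj,
        Complex.normSq_eq_norm_sq]
      push_cast; ring
  let T : Option ℕ → Set ℂ := fun o => o.elim (⋃ n, S ∩ X.B n)ᶜ fun n => S ∩ X.B n
  let g : Option ℕ → ℂ → ℂ := fun o => o.elim (fun _ => 1) fun n z => sgn (S.indicator (X.φ n) z)
  have hBm : ∀ n, MeasurableSet (S ∩ X.B n) := fun n =>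
    hS.measurableSet.inter (X.measurableSet_B n)
  obtain ⟨b, hbm, hb⟩ := exists_measurable_piecewise (β := ℂ) T
    (by rintro (_ | n)
        · exact (MeasurableSet.iUnion hBm).compl
        · exact hBm n) g
    (by rintro (_ | n)
        · exact (measurable_const : Measurable fun _ : ℂ => (1 : ℂ))
        · exact hsgnm.comp (measurable_indicator_of_mem_Q hS (X.mem_Q n)))
    (by rintro (_ | i) (_ | j) hij z ⟨hz1, hz2⟩
        · exact absurd rfl hij
        · exact absurd (Set.mem_iUnion.2 ⟨j, hz2⟩) hz1
        · exact absurd (Set.mem_iUnion.2 ⟨i, hz1⟩) hz2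
        · exact absurd hz2.2 (Set.disjoint_left.1
            (X.disjoint_B fun h => hij (congrArg some h)) hz1.2))
  refine ⟨b, hbm, fun z => ?_, fun n z hz => ?_⟩
  · by_cases hz : z ∈ ⋃ n, S ∩ X.B n
    · obtain ⟨n, hn⟩ := Set.mem_iUnion.1 hz
      rw [hb (some n) hn]
      exact hsgn1 _
    · rw [hb none hz]
      exact norm_one
  · rw [hb (some n) hz]
    change sgn (S.indicator (X.φ n) z) * _ = _
    rw [Set.indicator_of_mem hz.1, hsgn2]

/-- A Beltrami differential in the unit ball that vanishes on `C` and is aligned with `φ n` on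
`B n`. -/
structure Aligned (X : ConcentratedSystem S Δ D ψ L) (μ : Bel S) : Prop where
  eq_zero : ∀ᵐ z ∂volume.restrict S, z ∈ X.C → μ z = 0
  norm_le : ∀ᵐ z ∂volume.restrict S, ‖μ z‖ ≤ 1
  mul_eq : ∀ᵐ z ∂volume.restrict S, ∀ n, z ∈ X.B n → μ z * X.φ n z = ‖X.φ n z‖

variable {X : ConcentratedSystem S Δ D ψ L} {μ : Bel S}

theorem Aligned.le_re_pairing (h : X.Aligned μ) (n : ℕ) :
    (∫ z in S \ X.C, ‖X.φ n z‖) - 2 * X.e n ≤ (pairing μ (X.φ n)).re := by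
  have hφ := X.mem_Q n
  have hCm := X.measurableSet_C.compl
  have hBm := (X.measurableSet_B n).compl
  -- On `B n` the integrand is exactly `|φ n|`; elsewhere off `C` it is at least `-|φ n| = |φ n| - 2
  -- |φ n|`, which accounts for the factor 2.
  have h1 : ∫ z in S, (X.Cᶜ.indicator (fun z => ‖X.φ n z‖) z -
      2 * (X.Cᶜ ∩ (X.B n)ᶜ).indicator (fun z => ‖X.φ n z‖) z) ≤ ∫ z in S, (μ z * X.φ n z).re := by
    refine integral_mono_ae ((hφ.2.norm.indicator hCm).sub
      ((hφ.2.norm.indicator (hCm.inter hBm)).const_mul 2)) (integrable_mul μ hφ).re ?_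
    filter_upwards [h.eq_zero, h.norm_le, h.mul_eq] with z hz0 hz1 hzB
    by_cases hC : z ∈ X.C
    · have h2 : z ∉ X.Cᶜ := fun h => h hC
      have h3 : z ∉ X.Cᶜ ∩ (X.B n)ᶜ := fun h => h.1 hC
      simp [Set.indicator_of_notMem h2, Set.indicator_of_notMem h3, hz0 hC]
    · by_cases hB : z ∈ X.B n
      · have h3 : z ∉ X.Cᶜ ∩ (X.B n)ᶜ := fun h => h.2 hB
        rw [Set.indicator_of_mem (show z ∈ X.Cᶜ from hC), Set.indicator_of_notMem h3, hzB n hB]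
        simp
      · rw [Set.indicator_of_mem (show z ∈ X.Cᶜ from hC),
          Set.indicator_of_mem (show z ∈ X.Cᶜ ∩ (X.B n)ᶜ from ⟨hC, hB⟩)]
        have h4 := (abs_le.1 (Complex.abs_re_le_norm (μ z * X.φ n z))).1
        have h5 : ‖μ z * X.φ n z‖ ≤ ‖X.φ n z‖ := by
          rw [norm_mul]; exact mul_le_of_le_one_left (norm_nonneg _) hz1
        linarith
  rw [re_pairing μ hφ]
  refine le_trans ?_ h1
  rw [integral_sub (hφ.2.norm.indicator hCm) ((hφ.2.norm.indicator (hCm.inter hBm)).const_mul 2),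
    integral_const_mul, setIntegral_indicator hCm, setIntegral_indicator (hCm.inter hBm)]
  have h2 := X.integral_norm_le n
  rw [show S ∩ (X.Cᶜ ∩ (X.B n)ᶜ) = (S \ X.C) \ X.B n from (Set.inter_assoc _ _ _).symm,
    show S ∩ X.Cᶜ = S \ X.C from rfl]
  linarith

/-- Off `C`, `ν` cannot contribute more than `∫ |φ n|`, which `μ` attains up to `2 e n`. So the
contribution of `C` is at least `-2 e n`, and replacing `φ n` by `ψ n` there costs one more `e n`.
-/
theorem Aligned.neg_le_re_setIntegral (h : X.Aligned μ) (hCS : X.C ⊆ S)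
    (hψ : ∀ n, IntegrableOn (ψ n) X.C) {ν : Bel S} (hν : ‖ν‖ ≤ 1)
    (hc : cls ν = cls μ) (n : ℕ) :
    -(3 * X.e n) ≤ (∫ z in X.C, ν z * ψ n z).re := by
  have hφ := X.mem_Q n
  have hCm := X.measurableSet_C
  have hν1 : ∀ᵐ z ∂volume.restrict S, ‖ν z‖ ≤ 1 := (ae_norm_le ν).mono fun z hz => hz.trans hν
  have h1 := h.le_re_pairing n
  rw [← pairing_eq_of_cls_eq hc hφ, re_pairing ν hφ] at h1
  have hi := integrable_mul ν hφ
  have hir : Integrable (fun z => (ν z * X.φ n z).re) (volume.restrict S) := hi.re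
  have h2 : ∫ z in S, (ν z * X.φ n z).re ≤ ∫ z in S, (X.Cᶜ.indicator (fun z => ‖X.φ n z‖) z +
      X.C.indicator (fun z => (ν z * X.φ n z).re) z) := by
    refine integral_mono_ae hir ((hφ.2.norm.indicator hCm.compl).add (hir.indicator hCm)) ?_
    filter_upwards [hν1] with z hz1
    by_cases hC : z ∈ X.C
    · rw [Set.indicator_of_mem hC, Set.indicator_of_notMem (show z ∉ X.Cᶜ from fun h => h hC), zero_add]
    · rw [Set.indicator_of_notMem hC, Set.indicator_of_mem (show z ∈ X.Cᶜ from hC), add_zero]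
      refine (Complex.re_le_norm _).trans ?_
      rw [norm_mul]; exact mul_le_of_le_one_left (norm_nonneg _) hz1
  rw [integral_add (hφ.2.norm.indicator hCm.compl) (hir.indicator hCm),
    setIntegral_indicator hCm.compl, setIntegral_indicator hCm, Set.inter_eq_right.2 hCS,
    show S ∩ X.Cᶜ = S \ X.C from rfl] at h2
  have hiC : IntegrableOn (fun z => ν z * X.φ n z) X.C := IntegrableOn.mono_set hi hCS
  have hmono : volume.restrict X.C ≤ volume.restrict S := Measure.restrict_mono_set _ hCS
  have hν1C : ∀ᵐ z ∂volume.restrict X.C, ‖ν z‖ ≤ 1 := ae_mono hmono hν1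
  have hiψ : IntegrableOn (fun z => ν z * ψ n z) X.C :=
    (hψ n).bdd_mul ((Lp.aestronglyMeasurable ν).mono_measure hmono) hν1C
  have h3 : ∫ z in X.C, (ν z * X.φ n z).re = (∫ z in X.C, ν z * X.φ n z).re :=
    Complex.reCLM.integral_comp_comm hiC
  have h4 : ‖(∫ z in X.C, ν z * X.φ n z) - ∫ z in X.C, ν z * ψ n z‖ ≤ X.e n := by
    rw [← integral_sub hiC hiψ]
    refine le_trans ?_ (X.integral_norm_sub_le n)
    refine norm_integral_le_of_norm_le ((hφ.2.mono_set hCS).sub (hψ n)).norm ?_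
    filter_upwards [hν1C] with z hz
    rw [← mul_sub, norm_mul]
    exact mul_le_of_le_one_left (norm_nonneg _) hz
  have h5 := (Complex.re_le_norm _).trans h4
  rw [Complex.sub_re] at h5
  linarith

/-- Every element of the unit ball in the class of an aligned differential vanishes on `C`. -/
theorem Aligned.ae_eq_zero (h : X.Aligned μ) (hΔS : Δ ⊆ S) (hΔfin : volume Δ ≠ ⊤)
    (hψ : ∀ n, IntegrableOn (ψ n) Δ)
    (hrec : ∀ f : ℂ → ℂ, IntegrableOn f Δ → ∀ δ > 0, ∀ N : ℕ, ∃ n ≥ N,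
      ∫ z in Δ, ‖ψ n z - f z‖ < δ)
    {ν : Bel S} (hν : ‖ν‖ ≤ 1) (hc : cls ν = cls μ) :
    ∀ᵐ z ∂volume.restrict X.C, ν z = 0 := by
  have hCS : X.C ⊆ S := X.C_subset.trans hΔS
  have hCm := X.measurableSet_C
  have hmono : volume.restrict X.C ≤ volume.restrict S := Measure.restrict_mono_set _ hCS
  have hν1C : ∀ᵐ z ∂volume.restrict X.C, ‖ν z‖ ≤ 1 :=
    ae_mono hmono ((ae_norm_le ν).mono fun z hz => hz.trans hν)
  have hνm : AEStronglyMeasurable ν (volume.restrict X.C) :=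
    (Lp.aestronglyMeasurable ν).mono_measure hmono
  have hCfin : volume X.C ≠ ⊤ := measure_ne_top_of_subset X.C_subset hΔfin
  have hcm : AEStronglyMeasurable (fun z => -starRingEnd ℂ (ν z)) (volume.restrict X.C) :=
    (Complex.continuous_conj.comp_aestronglyMeasurable hνm).neg
  have hconj : IntegrableOn (fun z => -starRingEnd ℂ (ν z)) X.C :=
    (integrableOn_const (C := (1 : ℝ)) hCfin).mono' hcm (by
      filter_upwards [hν1C] with z hz
      rwa [norm_neg, RCLike.norm_conj])
  have hsq : IntegrableOn (fun z => ν z * -starRingEnd ℂ (ν z)) X.C := hconj.bdd_mul hνm hν1C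
  have hre : (∫ z in X.C, ν z * -starRingEnd ℂ (ν z)).re = -∫ z in X.C, ‖ν z‖ ^ 2 := by
    have h1 := Complex.reCLM.integral_comp_comm hsq
    rw [← Complex.reCLM_apply, ← h1, ← integral_neg]
    congr 1 with z
    rw [mul_neg, Complex.mul_conj, Complex.normSq_eq_norm_sq, Complex.reCLM_apply,
      Complex.neg_re, Complex.ofReal_re]
  have hle : ∫ z in X.C, ‖ν z‖ ^ 2 ≤ 0 := by
    refine le_of_forall_pos_le_add fun δ hδ => ?_
    obtain ⟨N, hN⟩ := Filter.eventually_atTop.1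
      (X.tendsto_e.eventually (gt_mem_nhds (show 0 < δ / 6 by positivity)))
    -- The worst test function for `ν` on `C` is `-conj ν`; recurrence supplies such an `n` with `e
    -- n` already small.
    obtain ⟨n, hn, hnδ⟩ := hrec (X.C.indicator fun z => -starRingEnd ℂ (ν z))
      ((integrable_indicator_iff hCm).2 hconj).integrableOn (δ / 2) (half_pos hδ) N
    have h1 := h.neg_le_re_setIntegral hCS (fun n => (hψ n).mono_set X.C_subset) hν hc n
    have hiψ : IntegrableOn (fun z => ν z * ψ n z) X.C :=
      ((hψ n).mono_set X.C_subset).bdd_mul hνm hν1C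
    have h2 : ‖(∫ z in X.C, ν z * ψ n z) - ∫ z in X.C, ν z * -starRingEnd ℂ (ν z)‖ ≤ δ / 2 := by
      rw [← integral_sub hiψ hsq]
      calc ‖∫ z in X.C, (ν z * ψ n z - ν z * -starRingEnd ℂ (ν z))‖
          ≤ ∫ z in X.C, ‖ψ n z - X.C.indicator (fun z => -starRingEnd ℂ (ν z)) z‖ := by
            refine norm_integral_le_of_norm_le (((hψ n).mono_set X.C_subset).sub
              ((integrable_indicator_iff hCm).2 hconj).integrableOn).norm ?_
            filter_upwards [hν1C, ae_restrict_mem hCm] with z hz hzC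
            rw [Set.indicator_of_mem hzC, ← mul_sub, norm_mul]
            exact mul_le_of_le_one_left (norm_nonneg _) hz
        _ ≤ ∫ z in Δ, ‖ψ n z - X.C.indicator (fun z => -starRingEnd ℂ (ν z)) z‖ :=
            setIntegral_mono_set ((hψ n).sub
              ((integrable_indicator_iff hCm).2 hconj).integrableOn).norm
              (.of_forall fun z => norm_nonneg _) X.C_subset.eventuallyLE
        _ ≤ δ / 2 := hnδ.le
    have h3 := (Complex.re_le_norm _).trans h2
    rw [Complex.sub_re, hre] at h3
    have h4 := hN n hn
    linarith
  have h0 : ∫ z in X.C, ‖ν z‖ ^ 2 = 0 :=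
    le_antisymm hle (integral_nonneg fun z => by positivity)
  have hint : Integrable (fun z => ‖ν z‖ ^ 2) (volume.restrict X.C) :=
    (integrableOn_const (C := (1 : ℝ)) hCfin).mono' (hνm.norm.pow 2) (by
      filter_upwards [hν1C] with z hz
      rw [norm_pow, norm_norm]
      exact pow_le_one₀ (norm_nonneg _) hz)
  filter_upwards [(integral_eq_zero_iff_of_nonneg (fun z => by positivity) hint).1 h0] with z hz
  simpa using hz

/-- The choice of `L` makes the mass of `φ n` on `C`, at most `1 + ∫ |ψ n|`, negligible against its
total mass. The normalised `φ n` therefore have pairings with `μ` whose real parts tend to 1. -/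
theorem Aligned.classNorm_eq_one (h : X.Aligned μ) (hμ : ‖μ‖ ≤ 1) (hΔS : Δ ⊆ S)
    (hψ : ∀ n, IntegrableOn (ψ n) Δ)
    (hL : ∀ n : ℕ, L n = (n + 1) * (1 + ∫ z in Δ, ‖ψ n z‖)) : classNorm (cls μ) = 1 := by
  have hCS : X.C ⊆ S := X.C_subset.trans hΔS
  have hub : ∀ r ∈ {r : ℝ | ∃ ν : Bel S, cls ν = cls μ ∧ ∃ φ ∈ Q1 S, r = (pairing ν φ).re},
      r ≤ 1 := by
    rintro r ⟨ν, hν, φ, hφ, rfl⟩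
    rw [pairing_eq_of_cls_eq hν hφ.1, ← hφ.2]
    refine (Complex.re_le_norm _).trans ?_
    refine norm_integral_le_of_norm_le hφ.1.2.norm ?_
    filter_upwards [ae_norm_le μ] with z hz
    rw [norm_mul]
    exact mul_le_of_le_one_left (norm_nonneg _) (hz.trans hμ)
  have hlow : ∀ n : ℕ, ∃ r ∈ {r : ℝ | ∃ ν : Bel S, cls ν = cls μ ∧
      ∃ φ ∈ Q1 S, r = (pairing ν φ).re}, 1 - 4 * (1 / ((n : ℝ) + 1)) ≤ r := by
    intro n
    set M : ℝ := ∫ z in S, ‖X.φ n z‖ with hM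
    set A : ℝ := ∫ z in Δ, ‖ψ n z‖
    have hA : 0 ≤ A := integral_nonneg fun z => norm_nonneg _
    have hLM : (n + 1) * (1 + A) ≤ M := by rw [← hL]; exact X.le_integral n
    have hMpos : 0 < M := lt_of_lt_of_le (by positivity) hLM
    have hφ := X.mem_Q n
    let φ : ℂ → ℂ := fun z => ((M⁻¹ : ℝ) : ℂ) * X.φ n z
    have hφQ : φ ∈ Q1 S := by
      refine ⟨⟨hφ.1.const_mul _, hφ.2.const_mul _⟩, ?_⟩
      simp only [φ, norm_mul, Complex.norm_real]
      rw [integral_const_mul, ← hM, Real.norm_of_nonneg (by positivity), inv_mul_cancel₀ hMpos.ne']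
    refine ⟨_, ⟨μ, rfl, φ, hφQ, rfl⟩, ?_⟩
    have h1 : pairing μ φ = ((M⁻¹ : ℝ) : ℂ) * pairing μ (X.φ n) := by
      unfold pairing
      rw [← integral_const_mul]
      congr 1 with z
      simp only [φ]; ring
    rw [h1, Complex.re_ofReal_mul]
    have h2 := h.le_re_pairing n
    have h3 : ∫ z in S \ X.C, ‖X.φ n z‖ = M - ∫ z in X.C, ‖X.φ n z‖ :=
      setIntegral_sdiff X.measurableSet_C hφ.2.norm hCS
    have h4 : ∫ z in X.C, ‖X.φ n z‖ ≤ 1 + A := by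
      have hψC : IntegrableOn (ψ n) X.C := (hψ n).mono_set X.C_subset
      have hφC : IntegrableOn (X.φ n) X.C := hφ.2.mono_set hCS
      calc ∫ z in X.C, ‖X.φ n z‖ ≤ ∫ z in X.C, (‖X.φ n z - ψ n z‖ + ‖ψ n z‖) := by
            refine setIntegral_mono hφC.norm ((hφC.sub hψC).norm.add hψC.norm) fun z => ?_
            simpa using norm_add_le (X.φ n z - ψ n z) (ψ n z)
        _ = (∫ z in X.C, ‖X.φ n z - ψ n z‖) + ∫ z in X.C, ‖ψ n z‖ :=
            integral_add (hφC.sub hψC).norm hψC.norm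
        _ ≤ 1 + A := add_le_add ((X.integral_norm_sub_le n).trans (X.e_le_one n))
            (setIntegral_mono_set (hψ n).norm (.of_forall fun z => norm_nonneg _)
              X.C_subset.eventuallyLE)
    have h5 : M - 4 * (1 + A) ≤ (pairing μ (X.φ n)).re := by
      have := X.e_le_one n
      linarith
    have h6 : (1 + A) / M ≤ 1 / ((n : ℝ) + 1) := by
      rw [div_le_div_iff₀ hMpos (by positivity)]
      linarith
    calc 1 - 4 * (1 / ((n : ℝ) + 1)) ≤ 1 - 4 * ((1 + A) / M) := by linarith
      _ = M⁻¹ * (M - 4 * (1 + A)) := by field_simp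
      _ ≤ M⁻¹ * (pairing μ (X.φ n)).re := by gcongr
  refine le_antisymm (csSup_le ((hlow 0).imp fun r hr => hr.1) hub) ?_
  have hlim : Filter.Tendsto (fun n : ℕ => 1 - 4 * (1 / ((n : ℝ) + 1))) Filter.atTop (nhds 1) := by
    have := (tendsto_one_div_add_atTop_nhds_zero_nat (𝕜 := ℝ)).const_mul 4 |>.const_sub 1
    simpa using this
  refine le_of_tendsto hlim (.of_forall fun n => ?_)
  obtain ⟨r, hr, hle⟩ := hlow n
  exact hle.trans (le_csSup ⟨1, hub⟩ hr)

end ConcentratedSystem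

/-! ### The class and its extremals. -/

theorem exists_of_ae_restrict {A : Set ℂ} (hA : 0 < volume A) {p : ℂ → Prop}
    (h : ∀ᵐ z ∂volume.restrict A, p z) : ∃ z, p z := by
  have : NeZero (volume.restrict A) := ⟨fun h => hA.ne' (Measure.restrict_eq_zero.1 h)⟩
  exact h.exists

theorem one_le_eLpNormEssSup {S E A : Set ℂ} {μ : Bel S} (hAE : A ⊆ E) (hA : 0 < volume A)
    (hμ : ∀ᵐ z ∂volume.restrict A, ‖μ z‖ = 1) :
    1 ≤ eLpNormEssSup μ (volume.restrict E) := by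
  have h1 := ae_mono (Measure.restrict_mono_set volume hAE)
    (ae_le_eLpNormEssSup (f := μ) (μ := volume.restrict E))
  obtain ⟨z, hz1, hz2⟩ := exists_of_ae_restrict hA (Filter.Eventually.and h1 hμ)
  rwa [← ofReal_norm, hz2, ENNReal.ofReal_one] at hz1

theorem exists_class_of_system {S Δ : Set ℂ} (hS : IsOpen S) (hΔS : Δ ⊆ S)
    (hΔfin : volume Δ ≠ ⊤) {y : ℂ} {s : ℝ} (hs : 0 < s) (hD : Metric.closedBall y s ⊆ S)
    (hDΔ : Disjoint (Metric.closedBall y s) Δ) {ψ : ℕ → ℂ → ℂ} {L : ℕ → ℝ}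
    (hψ : ∀ n, IntegrableOn (ψ n) Δ)
    (hrec : ∀ f : ℂ → ℂ, IntegrableOn f Δ → ∀ δ > 0, ∀ N : ℕ, ∃ n ≥ N,
      ∫ z in Δ, ‖ψ n z - f z‖ < δ)
    (hL : ∀ n : ℕ, L n = (n + 1) * (1 + ∫ z in Δ, ‖ψ n z‖))
    (X : ConcentratedSystem S Δ (Metric.closedBall y s) ψ L) :
    ∃ x : Z S, (nonLandslideExtremals x).Infinite ∧
      ∀ μ ∈ nonLandslideExtremals x, ¬ HasConstantModulus μ := by
  classical
  obtain ⟨b, hbm, hb1, hbφ⟩ := X.exists_unimodular hS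
  have hCS : X.C ⊆ S := X.C_subset.trans hΔS
  -- The centre is removed because `dir` is `0 / 0 = 0` there, hence not unimodular.
  let P : Set ℂ := Metric.ball y s \ {y}
  have hPm : MeasurableSet P := measurableSet_ball.diff (measurableSet_singleton y)
  have hPD : P ⊆ Metric.closedBall y s := fun z hz => Metric.ball_subset_closedBall hz.1
  have hPS : P ⊆ S := hPD.trans hD
  have hPC : ∀ z ∈ P, z ∉ X.C := fun z hz hzC =>
    Set.disjoint_left.1 hDΔ (hPD hz) (X.C_subset hzC)
  have hPpos : 0 < volume P := by
    rw [measure_sdiff_null (measure_singleton y)]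
    exact Metric.measure_ball_pos volume y hs
  let dir : ℂ → ℂ := fun z => (z - y) / ‖z - y‖
  have hdirm : Measurable dir := by
    have h1 : Measurable fun z : ℂ => z - y := measurable_id.sub_const y
    exact h1.div (Complex.measurable_ofReal.comp h1.norm)
  have hdir : ∀ z ∈ P, ‖dir z‖ = 1 := by
    intro z hz
    simp only [dir, norm_div, Complex.norm_real, norm_norm]
    exact div_self (norm_ne_zero_iff.2 (sub_ne_zero.2 hz.2))
  let f : ℂ → ℂ → ℂ := fun t => P.piecewise (fun z => t * dir z) (X.C.piecewise 0 b)
  have hfm : ∀ t, Measurable (f t) := fun t =>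
    (hdirm.const_mul t).piecewise hPm (measurable_const.piecewise X.measurableSet_C hbm)
  have hfP : ∀ t, ∀ z ∈ P, f t z = t * dir z := fun t z hz => Set.piecewise_eq_of_mem _ _ _ hz
  have hfnP : ∀ t z, z ∉ P → f t z = X.C.piecewise 0 b z := fun t z hz =>
    Set.piecewise_eq_of_notMem _ _ _ hz
  have hfC : ∀ t, ∀ z ∈ X.C, f t z = 0 := by
    intro t z hz
    rw [hfnP t z fun h => hPC z h hz, Set.piecewise_eq_of_mem _ _ _ hz]
    rfl
  have hfb : ∀ t z, z ∉ P → z ∉ X.C → f t z = b z := by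
    intro t z hz hzC
    rw [hfnP t z hz, Set.piecewise_eq_of_notMem _ _ _ hzC]
  have hf1 : ∀ t, ‖t‖ = 1 → ∀ z, z ∉ X.C → ‖f t z‖ = 1 := by
    intro t ht z hz
    by_cases hzP : z ∈ P
    · rw [hfP t z hzP, norm_mul, ht, hdir z hzP, one_mul]
    · rw [hfb t z hzP hz, hb1]
  have hfle : ∀ t, ‖t‖ = 1 → ∀ z, ‖f t z‖ ≤ 1 := by
    intro t ht z
    by_cases hz : z ∈ X.C
    · rw [hfC t z hz, norm_zero]; exact zero_le_one
    · exact (hf1 t ht z hz).le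
  let 𝕋 := Metric.sphere (0 : ℂ) 1
  have hT : ∀ t : 𝕋, ‖(t : ℂ)‖ = 1 := fun t => mem_sphere_zero_iff_norm.1 t.2
  have hmem : ∀ t : 𝕋, MemLp (f t) ⊤ (volume.restrict S) := fun t =>
    memLp_top_of_bound (hfm t).aestronglyMeasurable 1 (.of_forall (hfle t (hT t)))
  let M : 𝕋 → Bel S := fun t => (hmem t).toLp (f t)
  have hM : ∀ t, M t =ᵐ[volume.restrict S] f t := fun t => (hmem t).coeFn_toLp
  have hM' : ∀ t, ∀ A ⊆ S, M t =ᵐ[volume.restrict A] f t := fun t A hA =>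
    ae_mono (Measure.restrict_mono_set volume hA) (hM t)
  have hal : ∀ t, X.Aligned (M t) := by
    refine fun t => ⟨?_, ?_, ?_⟩
    · filter_upwards [hM t] with z hz hzC
      rw [hz, hfC _ z hzC]
    · filter_upwards [hM t] with z hz
      rw [hz]; exact hfle t (hT t) z
    · filter_upwards [hM t, ae_restrict_mem hS.measurableSet] with z hz hzS n hzB
      rw [hz, hfb t z (fun h => Set.disjoint_left.1 (X.disjoint_BD n) hzB (hPD h))
        (Set.disjoint_left.1 (X.disjoint_BC n) hzB)]
      exact hbφ n z ⟨hzS, hzB⟩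
  have hsup : ∀ t, eLpNormEssSup (M t) (volume.restrict S) = 1 := by
    intro t
    refine le_antisymm ?_ (one_le_eLpNormEssSup hPS hPpos ?_)
    · refine essSup_le_of_ae_le _ ?_
      filter_upwards [(hal t).norm_le] with z hz
      rw [← ofReal_norm]
      exact ENNReal.ofReal_le_one.2 hz
    · filter_upwards [hM' t P hPS, ae_restrict_mem hPm] with z hz hzP
      rw [hz, hf1 t (hT t) z (hPC z hzP)]
  have hnorm : ∀ t, ‖M t‖ = 1 := by
    intro t
    rw [Lp.norm_def, eLpNorm_exponent_top, hsup, ENNReal.toReal_one]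
  let t₀ : 𝕋 := ⟨1, by simp [𝕋]⟩
  have hclass : ∀ t, cls (M t) = cls (M t₀) := by
    intro t
    -- Two members of the family differ by a multiple of `dir` on the disc, which annihilates
    -- `Q(S)`.
    refine (Submodule.Quotient.eq _).2 fun φ hφ => ?_
    have h1 : pairing (M t - M t₀) φ =
        ∫ z in S, (Metric.ball y s).indicator (fun z => ((t : ℂ) - t₀) * (dir z * φ z)) z := by
      refine integral_congr_ae ?_
      filter_upwards [Lp.coeFn_sub (M t) (M t₀), hM t, hM t₀] with z h1 h2 h3
      rw [h1, Pi.sub_apply, h2, h3]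
      by_cases hzP : z ∈ P
      · rw [hfP _ z hzP, hfP _ z hzP, Set.indicator_of_mem hzP.1]
        ring
      · rw [hfnP _ z hzP, hfnP _ z hzP, sub_self, zero_mul]
        by_cases hzb : z ∈ Metric.ball y s
        · have hzy : z = y := by
            by_contra hne
            exact hzP ⟨hzb, hne⟩
          rw [Set.indicator_of_mem hzb, hzy]
          simp [dir]
        · rw [Set.indicator_of_notMem hzb]
    rw [h1, setIntegral_indicator measurableSet_ball,
      Set.inter_eq_right.2 (Metric.ball_subset_closedBall.trans hD), integral_const_mul,
      setIntegral_ball_direction_mul_eq_zero hS hφ hD, mul_zero]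
  have hcn : classNorm (cls (M t₀)) = 1 :=
    (hal t₀).classNorm_eq_one (hnorm t₀).le hΔS hψ hL
  refine ⟨cls (M t₀), ?_, ?_⟩
  · have hinj : Function.Injective M := by
      intro t t' h
      have h1 : ∀ᵐ z ∂volume.restrict P, f t z = f t' z := by
        filter_upwards [hM' t P hPS, hM' t' P hPS] with z h1 h2
        rw [← h1, ← h2, h]
      obtain ⟨z, hz, hzf⟩ := exists_of_ae_restrict hPpos ((ae_restrict_mem hPm).and h1)
      rw [hfP _ z hz, hfP _ z hz] at hzf
      have hne : dir z ≠ 0 := norm_ne_zero_iff.1 (by rw [hdir z hz]; exact one_ne_zero)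
      exact Subtype.ext (mul_right_cancel₀ hne hzf)
    have hinf : Infinite 𝕋 := by
      refine Set.infinite_coe_iff.2 ((isPreconnected_sphere_complex 0 1).infinite_of_nontrivial ?_)
      exact ⟨1, by simp, -1, by simp, by norm_num⟩
    refine (Set.infinite_range_of_injective hinj).mono ?_
    rintro _ ⟨t, rfl⟩
    refine ⟨hclass t, ?_, ?_⟩
    · rw [IsExtremal, hclass t, hcn, hnorm t]
    · rintro ⟨E, hE, hEne, hES, hlt⟩
      rw [hsup t] at hlt
      refine hlt.not_ge (one_le_eLpNormEssSup (A := E \ X.C) Set.sdiff_subset ?_ ?_)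
      · by_cases hEΔ : (E ∩ Δ).Nonempty
        · exact X.measure_diff_pos E hE hEΔ
        · have : E \ X.C = E := sdiff_eq_left.2 (Set.disjoint_left.2 fun z hz hzC =>
            hEΔ ⟨z, hz, X.C_subset hzC⟩)
          rw [this]
          exact hE.measure_pos _ hEne
      · filter_upwards [hM' t (E \ X.C) (Set.sdiff_subset.trans hES),
          ae_restrict_mem (hE.measurableSet.diff X.measurableSet_C)] with z hz hzE
        rw [hz, hf1 t (hT t) z hzE.2]
  -- Vanishing on `C` forces the constant to be 0, contradicting norm 1. This applies to every
  -- extremal of the class, not only to the family `M`.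
  · rintro ν ⟨hν, hext, -⟩ ⟨c, hc⟩
    have hν1 : ‖ν‖ = 1 := by rw [hext, hν, hcn]
    have h0 := (hal t₀).ae_eq_zero hΔS hΔfin hψ hrec hν1.le hν
    have h1 := ae_mono (Measure.restrict_mono_set volume hCS) hc
    obtain ⟨z, hz0, hzc⟩ := exists_of_ae_restrict X.C_pos (h0.and h1)
    rw [hz0, norm_zero] at hzc
    have h2 : ν = 0 := by
      refine (Lp.eq_zero_iff_ae_eq_zero).2 ?_
      filter_upwards [hc] with z hz
      rw [← hzc] at hz
      exact norm_eq_zero.1 hz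
    rw [h2, norm_zero] at hν1
    exact zero_ne_one hν1

end Teich

theorem mainTheorem2 (S : Set ℂ) (hS : IsOpen S) (hconn : IsConnected S)
    (hbdry : (frontier S).Infinite) :
    ∃ x : Teich.Z S,
      (Teich.nonLandslideExtremals x).Infinite ∧
      ∀ μ ∈ Teich.nonLandslideExtremals x, ¬ Teich.HasConstantModulus μ := by
  have hfr : frontier S ⊆ Sᶜ := fun z hz => by
    rw [hS.frontier_eq] at hz; exact hz.2
  obtain ⟨a, ha⟩ := hbdry.nonempty
  obtain ⟨b, hb, hab⟩ := hbdry.exists_notMem_finset {a}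
  obtain ⟨c, hc, habc⟩ := hbdry.exists_notMem_finset {a, b}
  simp only [Finset.mem_singleton, Finset.mem_insert, not_or] at hab habc
  -- Three boundary points serve as the fixed poles; infinitely many points of the complement remain
  -- for the uniqueness argument.
  have hW : (Sᶜ \ {a, b, c}).Infinite :=
    (hbdry.mono hfr).sdiff (Set.toFinite {a, b, c})
  obtain ⟨x₀, hx₀⟩ := hconn.nonempty
  obtain ⟨δ, hδ, hball⟩ := Metric.isOpen_iff.1 hS x₀ hx₀
  have hr : 0 < δ / 3 := by positivity
  obtain ⟨y, s, hs, hD, hDΔ, H⟩ := Teich.exists_isDetermining hS Set.sdiff_subset hW hr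
    (x₀ := x₀) (by rwa [mul_div_cancel₀ δ three_ne_zero])
  have hΔS : Metric.ball x₀ (δ / 3) ⊆ S :=
    (Metric.ball_subset_ball (by linarith)).trans hball
  have hΔfin : volume (Metric.ball x₀ (δ / 3)) ≠ ⊤ := measure_ball_lt_top.ne
  obtain ⟨ψ, hψ, hrec⟩ := Teich.exists_recurrent_seq (Metric.ball x₀ (δ / 3))
  obtain ⟨X⟩ := Teich.exists_concentratedSystem hS Metric.isOpen_ball hΔS
    ⟨x₀, Metric.mem_ball_self hr⟩ hΔfin hψ
    (L := fun n => (n + 1) * (1 + ∫ z in Metric.ball x₀ (δ / 3), ‖ψ n z‖))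
    (fun n ε hε m _ hm U hU => Teich.exists_concentrated hS Metric.isOpen_ball hΔS
      ⟨x₀, Metric.mem_ball_self hr⟩ hΔfin H
      (fun O hO f hf hf0 ε hε => Teich.exists_Q_approx hS (hfr ha) (hfr hb) (hfr hc)
        (Ne.symm hab) (Ne.symm habc.1) (Ne.symm habc.2) hO hf hf0 hε) m hm hU (hψ n) hε _)
  exact Teich.exists_class_of_system hS hΔS hΔfin hs hD hDΔ hψ hrec (fun _ => rfl) X
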